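/- \textbf{Setting.} Let $G=\mathrm{Isom}(\mathbb H^2)\cong \mathrm{PGL}_2(\mathbb R)$ and let $\mathfrak g=\mathfrak{sl}_2(\mathbb R)$ be the Lie algebra of Killing fields of $\mathbb H^2$, with $G$ acting by $\mathrm{Ad}$. Let $\rho_0:\Gamma\to G$ be a homomorphism through which $\Gamma$ acts freely and properly discontinuously on $\mathbb H^2$, with quotient hyperbolic surface $\Sigma_0=\rho_0(\Gamma)\backslash\mathbb H^2$. Let $\alpha_1,\dots,\alpha_r\subset\Sigma_0$ be pairwise disjoint properly embedded (bi-infinite) geodesic arcs, let $\widetilde{\mathscr A}$ be the set of all their lifts to $\mathbb H^2$, and call \emph{tiles} the connected components of $\mathbb H^2\setminus\bigcup_{\widetilde\alpha\in\widetilde{\mathscr A}}\widetilde\alpha$. An \emph{infinitesimal strip deformation} supported on these arcs, with waists $p_i\in\alpha_i$, widths $w_i>0$ and deformation cocycle $u:\Gamma\to\mathfrak g$ (so $u(\gamma\delta)=u(\gamma)+\mathrm{Ad}(\rho_0(\gamma))u(\delta)$), assigns to each tile $\Delta$ a Killing field $\xi_\Delta\in\mathfrak g$ such that (i) $\xi_{\rho_0(\gamma)\Delta}=\mathrm{Ad}(\rho_0(\gamma))\,\xi_\Delta+u(\gamma)$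 for all $\gamma\in\Gamma$ and all tiles $\Delta$; (ii) if two tiles $\Delta\ne\Delta'$ are adjacent along a lift $\widetilde\alpha$ of $\alpha_i$, then $\xi_\Delta-\xi_{\Delta'}$ is the infinitesimal translation with velocity $w_i$, in the direction of $\Delta'$, along the axis that crosses $\widetilde\alpha$ orthogonally at the point of $\widetilde\alpha$ lying over $p_i$. For $\widetilde\alpha\in\widetilde{\mathscr A}$, with adjacent tiles $\Delta,\Delta'$, put $\mathbf v_{\widetilde\alpha}:=\tfrac12(\xi_\Delta+\xi_{\Delta'})$. For a transversely oriented geodesic $\ell\subset\mathbb H^2$ with positive open half-plane $h_\ell$, and $\mathbf v\in\mathfrak g$, the closed \emph{crooked halfspace} $\mathrm{CH}(\mathbf v,\ell)\subset\mathfrak g$ is the set of all $\mathbf w\in\mathfrak g$ such that the Killing field $\mathbf w-\mathbf v$ has a non-attracting fixed point in the closure of $h_\ell$ in $\overline{\mathbb H^2}=\mathbb H^2\cup\partial\mathbb H^2$. Here the only attracting fixed points are the attracting endpoints of the axes of hyperbolic Killing fields; fixed points of elliptic and parabolic fields are non-attracting, as is every point for the zero field. \textbf{Lemma.} Let $\widetilde\alpha\neq\widetilde\alpha'$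 be two distinct elements of $\widetilde{\mathscr A}$, transversely oriented so that the positive half-plane of $\widetilde\alpha$ is contained in that of $\widetilde\alpha'$. Then $$\mathrm{CH}(\mathbf v_{\widetilde\alpha},\widetilde\alpha)\subset \mathrm{Int}\big(\mathrm{CH}(\mathbf v_{\widetilde\alpha'},\widetilde\alpha')\big).$$ -/

import Mathlib

open Set
open scoped Pointwise UpperHalfPlane MatrixGroups

namespace CrookedStrip

/-! ### The hyperbolic plane and its Killing fields

`G = PGL(2, ℝ)` is the full isometry group of the hyperbolic plane `ℍ`, and `𝔤 = sl(2, ℝ)` with the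
form `v · w = tr (v w) / 2` is the Lorentzian space of Killing fields of `ℍ`. -/

/-- The Lie algebra `sl(2, ℝ)` of traceless real `2 × 2` matrices (with its usual topology), seen as
the space of Killing fields of `ℍ`. -/
abbrev KillingField : Type := LieAlgebra.SpecialLinear.sl (Fin 2) ℝ

/-- The Lorentzian inner product `v · w = tr (v w) / 2`, of signature `(2, 1)`. -/
noncomputable def form (v w : KillingField) : ℝ := (1 / 2) * (v.1 * w.1).trace

/-- The isometry `x + i y ↦ (1 / y) [x, -(x² + y²); 1, -x]` of the upper half plane onto the
hyperboloid of future-pointing `v` with `v · v = -1`. In this model the Killing field `ξ` is the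
vector field `p ↦ ⁅ξ, p⁆`. -/
noncomputable def hyp (z : ℍ) : KillingField :=
  ⟨(1 / z.im) • !![z.re, -(z.re ^ 2 + z.im ^ 2); 1, -z.re], by
    change Matrix.trace (n := Fin 2) (R := ℝ) _ = 0
    simp [Matrix.trace_fin_two]⟩

/-- The adjoint action `ξ ↦ g ξ g⁻¹` of an invertible matrix on `sl(2, ℝ)`. -/
noncomputable def AdGL (g : GL (Fin 2) ℝ) (ξ : KillingField) : KillingField :=
  ⟨g.1 * ξ.1 * (g⁻¹).1, by
    change Matrix.trace (n := Fin 2) (R := ℝ) _ = 0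
    rw [Matrix.trace_mul_cycle, ← Units.val_mul, inv_mul_cancel, Units.val_one, one_mul]
    exact ξ.2⟩

theorem AdGL_eq_of_mk_eq {g h : GL (Fin 2) ℝ}
    (hgh : Matrix.ProjGenLinGroup.mk g = Matrix.ProjGenLinGroup.mk h) : AdGL g = AdGL h := by
  obtain ⟨z, hz, rfl⟩ := Matrix.ProjGenLinGroup.mk_eq_mk_iff.1 hgh
  funext ξ
  apply Subtype.ext
  have h1 : ((Matrix.GeneralLinearGroup.scalar (Fin 2) z : GL (Fin 2) ℝ)).1
      = (z : ℝ) • (1 : Matrix (Fin 2) (Fin 2) ℝ) := by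
    ext i j
    simp [Matrix.GeneralLinearGroup.scalar, Matrix.diagonal_apply, Matrix.one_apply]
  have h2 : ((Matrix.GeneralLinearGroup.scalar (Fin 2) z : GL (Fin 2) ℝ))⁻¹.1
      = ((z⁻¹ : ℝˣ) : ℝ) • (1 : Matrix (Fin 2) (Fin 2) ℝ) := by
    rw [← map_inv]
    ext i j
    simp [Matrix.GeneralLinearGroup.scalar, Matrix.diagonal_apply, Matrix.one_apply]
  simp only [AdGL, mul_inv_rev, Units.val_mul, h1, h2]
  simp [smul_smul]

/-- The adjoint action of `G = PGL(2, ℝ)` on `𝔤`, i.e. the action of isometries on Killing fields. -/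
noncomputable def Ad (g : PGL(2, ℝ)) : KillingField → KillingField :=
  AdGL (Function.surjInv Matrix.ProjGenLinGroup.mk_surjective g)

theorem Ad_mk (g : GL (Fin 2) ℝ) : Ad (Matrix.ProjGenLinGroup.mk g) = AdGL g :=
  AdGL_eq_of_mk_eq (Function.surjInv_eq Matrix.ProjGenLinGroup.mk_surjective _)

/-! ### Transversely oriented geodesics and crooked halfspaces -/

/-- A unit spacelike vector `n`; it stands for the geodesic `geodesic n` with the transverse
orientation that points to its positive side `halfPlane n`. -/
def IsUnitSpacelike (n : KillingField) : Prop := form n n = 1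

/-- The geodesic of `ℍ` orthogonal to `n`. -/
def geodesic (n : KillingField) : Set ℍ := {z | form (hyp z) n = 0}

/-- The open half plane on the positive side of `geodesic n`. -/
def halfPlane (n : KillingField) : Set ℍ := {z | 0 < form (hyp z) n}

/-- A nonzero future-pointing vector `x` with `x · x ≤ 0`. The rays through such vectors are the
points of the closed disc `ℍ ∪ ∂ℍ`: timelike rays are the points of `ℍ`, null rays are the points of
the ideal boundary. -/
def IsFutureCausal (x : KillingField) : Prop :=
  form x x ≤ 0 ∧ 0 < (x.1 1 0 - x.1 0 1) / 2

/-- The point of the closed disc given by `x` is fixed by the Killing field `w` and is not an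
attracting fixed point. The flow of `w` acts on `x` by the exponential of `⁅w, ·⁆`, so `[x]` is fixed
iff `⁅w, x⁆ = c x` for some `c`, and it is attracting iff moreover `c > 0`. (If `x` is timelike then
`c = 0`; at the fixed point of a parabolic field also `c = 0`.) -/
def IsNonAttractingFixedPoint (w x : KillingField) : Prop :=
  ∃ c : ℝ, c ≤ 0 ∧ ⁅w, x⁆ = c • x

/-- The closed crooked halfspace `CH(v, ℓ)`, for `ℓ = geodesic n` transversely oriented by `n`: all
Killing fields `w` such that `w - v` has a non-attracting fixed point in the closure, in the closed
disc, of the positive half plane of `ℓ`. -/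
def CH (v n : KillingField) : Set KillingField :=
  {w | ∃ x, IsFutureCausal x ∧ 0 ≤ form x n ∧ IsNonAttractingFixedPoint (w - v) x}

/-! ### The surface and its arcs -/

/-- `ρ₀ : Γ → G` is a discrete embedding with torsion-free image, i.e. `Γ` acts properly
discontinuously and freely on `ℍ`, so that `Σ₀ = ρ₀(Γ) \ ℍ` is a complete hyperbolic surface. -/
structure IsSurfaceGroup {Γ : Type*} [Group Γ] (ρ₀ : Γ →* PGL(2, ℝ)) : Prop where
  properlyDiscontinuous : ProperlyDiscontinuousSMul ρ₀.range ℍ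
  free : ∀ γ : Γ, γ ≠ 1 → ∀ z : ℍ, ρ₀ γ • z ≠ z

/-- The surface `Σ₀ = ρ₀(Γ) \ ℍ`, with the quotient topology. -/
abbrev Surface {Γ : Type*} [Group Γ] (ρ₀ : Γ →* PGL(2, ℝ)) : Type :=
  Quotient (MulAction.orbitRel ρ₀.range ℍ)

/-- The covering map `ℍ → Σ₀`. -/
noncomputable def proj {Γ : Type*} [Group Γ] (ρ₀ : Γ →* PGL(2, ℝ)) (z : ℍ) : Surface ρ₀ :=
  Quotient.mk _ z

/-- A family of pairwise disjoint properly embedded geodesic arcs `αᵢ` in `Σ₀`. Each `αᵢ` is recorded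
by one of its lifts `arc i`, a complete geodesic of `ℍ` that is mapped onto `αᵢ` injectively and
properly. -/
structure ArcSystem {Γ : Type*} [Group Γ] (ρ₀ : Γ →* PGL(2, ℝ)) (ι : Type*) where
  arc : ι → Set ℍ
  isGeodesic : ∀ i, ∃ n, IsUnitSpacelike n ∧ arc i = geodesic n
  injective : ∀ i, InjOn (proj ρ₀) (arc i)
  proper : ∀ i, IsProperMap (fun z : arc i => proj ρ₀ z)
  disjoint : ∀ i j, i ≠ j → Disjoint (proj ρ₀ '' arc i) (proj ρ₀ '' arc j)

namespace ArcSystem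

variable {Γ : Type*} [Group Γ] {ρ₀ : Γ →* PGL(2, ℝ)} {ι : Type*}

/-- The set of all lifts to `ℍ` of the arcs. -/
def lifts (A : ArcSystem ρ₀ ι) : Set (Set ℍ) := {L | ∃ (γ : Γ) (i : ι), L = ρ₀ γ • A.arc i}

/-- The tiles: the connected components of the complement in `ℍ` of all lifted arcs. -/
def tiles (A : ArcSystem ρ₀ ι) : Set (Set ℍ) :=
  {Δ | ∃ z ∈ (⋃₀ A.lifts)ᶜ, Δ = connectedComponentIn (⋃₀ A.lifts)ᶜ z}

/-- `Δ` and `Δ'` are the two tiles adjacent along the lifted arc `L`. -/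
def Adjacent (A : ArcSystem ρ₀ ι) (Δ Δ' L : Set ℍ) : Prop :=
  Δ ∈ A.tiles ∧ Δ' ∈ A.tiles ∧ Δ ≠ Δ' ∧ L ∈ A.lifts ∧ L ⊆ closure Δ ∧ L ⊆ closure Δ'

end ArcSystem

/-! ### Infinitesimal strip deformations -/

/-- Let `n` be a unit tangent vector at `p ∈ ℍ`, and `c(t) = cosh t • p + sinh t • n` the unit speed
geodesic through `p` with velocity `n` there. `ψ` is the infinitesimal translation along the axis `c`,
in the direction of `n` and with velocity `w`, iff the Killing field of `ψ` is `w • c'(t)` at every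
point `c(t)` of the axis. -/
def IsInfinitesimalTranslation (ψ : KillingField) (p : ℍ) (n : KillingField) (w : ℝ) : Prop :=
  ∀ t : ℝ, ⁅ψ, Real.cosh t • hyp p + Real.sinh t • n⁆
    = w • (Real.sinh t • hyp p + Real.cosh t • n)

/-- An infinitesimal strip deformation supported on the arcs of `A`: a `(ρ₀, u)`-equivariant piecewise
Killing vector field, equal to the Killing field `ξ Δ` on each tile `Δ`, and to `motion L` along each
lifted arc `L`. -/
structure InfinitesimalStripDeformation {Γ : Type*} [Group Γ] {ρ₀ : Γ →* PGL(2, ℝ)} {ι : Type*}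
    (A : ArcSystem ρ₀ ι) where
  /-- the waist `pᵢ ∈ αᵢ`, recorded by its lift to `arc i` -/
  waist : ι → ℍ
  waist_mem : ∀ i, waist i ∈ A.arc i
  /-- the width `wᵢ > 0` -/
  width : ι → ℝ
  width_pos : ∀ i, 0 < width i
  /-- the deformation cocycle -/
  u : Γ → KillingField
  cocycle : ∀ γ δ, u (γ * δ) = u γ + Ad (ρ₀ γ) (u δ)
  /-- the Killing field on each tile -/
  ξ : Set ℍ → KillingField
  equivariant : ∀ γ, ∀ Δ ∈ A.tiles, ξ (ρ₀ γ • Δ) = Ad (ρ₀ γ) (ξ Δ) + u γ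
  /-- The motion `ξ Δ - ξ Δ'` of `Δ` relative to an adjacent tile `Δ'` is an infinitesimal translation
  along the axis that crosses the common arc orthogonally at the lifted waist, in the direction of
  `Δ'`, with velocity the width. Here `n` is the unit normal of the common arc that points to `Δ'`. -/
  relative_motion : ∀ γ i Δ Δ', A.Adjacent Δ Δ' (ρ₀ γ • A.arc i) →
    ∃ n, IsUnitSpacelike n ∧ geodesic n = ρ₀ γ • A.arc i ∧ Δ' ⊆ halfPlane n ∧
      IsInfinitesimalTranslation (ξ Δ - ξ Δ') (ρ₀ γ • waist i) n (width i)
  /-- the infinitesimal motion `v_L` of each lifted arc -/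
  motion : Set ℍ → KillingField
  motion_eq : ∀ L Δ Δ', A.Adjacent Δ Δ' L → motion L = (1 / 2 : ℝ) • (ξ Δ + ξ Δ')

end CrookedStrip

namespace CrookedStrip

/-! ### Algebra of `sl(2, ℝ)` -/

/-! Write `v`, `v'` for the motions of the two arcs. Every Killing field has a non-attracting fixed
point in the closed disc, so anything outside `CH v' (-n')` lies in `CH v' n'`; as `CH v' (-n')` is
closed, its complement is an open subset of `CH v' n'`. It therefore suffices that `CH v n` and `CH
v' (-n')` are disjoint (`disjoint_CH`).

Suppose `w` lies in both, with fixed points `x` on the positive side of `n` and `y` on the negative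
side of `n'`, and multipliers `c, d ≤ 0`. Invariance of the form gives `form ⁅v - v', x⁆ y = -(c +
d) * form x y ≤ 0`, because causal vectors have nonpositive product. On the other hand `v - v'` is a
sum of relative motions of adjacent tiles: half a strip at each end and a full strip at each arc in
between. Each strip pulls apart points on opposite sides of its arc (`relative_motion_form`, from
the explicit formula `form_bracket_eq`), so the same quantity is `≥ 0`, and it is `> 0` unless `x`
and `y` are orthogonal to both `n` and `n'` (`motion_form`).

In the remaining case `x` and `y` are one common ideal endpoint of the two arcs, and `⁅v - v', x⁆ =
(d - c) • x`. Replacing one of the two fixed points by a point of `ℍ` on an arc makes the inequality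
strict; doing this on either side forces both `d < c` and `c < d`.

The sum over strips needs only finitely many arcs between the two, which follows from proper
discontinuity and properness of the arcs, and a description of tiles by the arcs that separate
points. -/

theorem KillingField.apply_one_one (v : KillingField) : v.1 1 1 = -v.1 0 0 := by
  have h : Matrix.trace (n := Fin 2) (R := ℝ) v.1 = 0 := v.2
  rw [Matrix.trace_fin_two] at h
  linarith

theorem KillingField.ext_entries {v w : KillingField} (h00 : v.1 0 0 = w.1 0 0)
    (h01 : v.1 0 1 = w.1 0 1) (h10 : v.1 1 0 = w.1 1 0) : v = w := by
  apply Subtype.ext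
  ext i j
  fin_cases i <;> fin_cases j
  · exact h00
  · exact h01
  · exact h10
  · simpa [KillingField.apply_one_one] using h00

/-- The Killing field `[a, b; c, -a]`. -/
def ofEntries (a b c : ℝ) : KillingField :=
  ⟨!![a, b; c, -a], by
    change Matrix.trace (n := Fin 2) (R := ℝ) _ = 0
    simp [Matrix.trace_fin_two]⟩

theorem ofEntries_zero_zero (a b c : ℝ) : (ofEntries a b c).1 0 0 = a := rfl
theorem ofEntries_zero_one (a b c : ℝ) : (ofEntries a b c).1 0 1 = b := rfl
theorem ofEntries_one_zero (a b c : ℝ) : (ofEntries a b c).1 1 0 = c := rfl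

theorem form_eq (v w : KillingField) :
    form v w = v.1 0 0 * w.1 0 0 + (v.1 0 1 * w.1 1 0 + v.1 1 0 * w.1 0 1) / 2 := by
  simp only [form, Matrix.trace_fin_two, Matrix.mul_apply, Fin.sum_univ_two,
    KillingField.apply_one_one]
  ring

theorem form_comm (v w : KillingField) : form v w = form w v := by
  rw [form_eq, form_eq]; ring

theorem add_entry (v w : KillingField) (i j : Fin 2) : (v + w).1 i j = v.1 i j + w.1 i j := rfl
theorem sub_entry (v w : KillingField) (i j : Fin 2) : (v - w).1 i j = v.1 i j - w.1 i j := rfl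
theorem neg_entry (v : KillingField) (i j : Fin 2) : (-v).1 i j = -v.1 i j := rfl
theorem smul_entry (c : ℝ) (v : KillingField) (i j : Fin 2) : (c • v).1 i j = c * v.1 i j := rfl
theorem bracket_val (v w : KillingField) : ⁅v, w⁆.1 = v.1 * w.1 - w.1 * v.1 := rfl

theorem form_add_left (u v w : KillingField) : form (u + v) w = form u w + form v w := by
  simp only [form_eq, add_entry]; ring

theorem form_sub_left (u v w : KillingField) : form (u - v) w = form u w - form v w := by
  simp only [form_eq, sub_entry]; ring

theorem form_smul_left (c : ℝ) (v w : KillingField) : form (c • v) w = c * form v w := by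
  simp only [form_eq, smul_entry]; ring

theorem form_neg_left (v w : KillingField) : form (-v) w = -form v w := by
  simp only [form_eq, neg_entry]; ring

theorem form_add_right (u v w : KillingField) : form u (v + w) = form u v + form u w := by
  rw [form_comm, form_add_left, form_comm v, form_comm w]

theorem form_smul_right (c : ℝ) (v w : KillingField) : form v (c • w) = c * form v w := by
  rw [form_comm, form_smul_left, form_comm]

theorem form_neg_right (v w : KillingField) : form v (-w) = -form v w := by
  rw [form_comm, form_neg_left, form_comm]

theorem bracket_zero_zero (v w : KillingField) :
    ⁅v, w⁆.1 0 0 = v.1 0 1 * w.1 1 0 - w.1 0 1 * v.1 1 0 := by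
  rw [bracket_val]
  simp only [Matrix.sub_apply, Matrix.mul_apply, Fin.sum_univ_two]
  ring

theorem bracket_zero_one (v w : KillingField) :
    ⁅v, w⁆.1 0 1 = 2 * (v.1 0 0 * w.1 0 1 - w.1 0 0 * v.1 0 1) := by
  rw [bracket_val]
  simp only [Matrix.sub_apply, Matrix.mul_apply, Fin.sum_univ_two, KillingField.apply_one_one]
  ring

theorem bracket_one_zero (v w : KillingField) :
    ⁅v, w⁆.1 1 0 = 2 * (v.1 1 0 * w.1 0 0 - w.1 1 0 * v.1 0 0) := by
  rw [bracket_val]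
  simp only [Matrix.sub_apply, Matrix.mul_apply, Fin.sum_univ_two, KillingField.apply_one_one]
  ring

theorem form_bracket (u v w : KillingField) : form ⁅u, v⁆ w = form u ⁅v, w⁆ := by
  simp only [form_eq, bracket_zero_zero, bracket_zero_one, bracket_one_zero]
  ring

theorem form_bracket_self (u v : KillingField) : form ⁅u, v⁆ u = 0 := by
  simp only [form_eq, bracket_zero_zero, bracket_zero_one, bracket_one_zero]
  ring

/-- The Lorentzian triple product identity; the factor 4 reflects the normalization `tr / 2` of the
form. -/
theorem bracket_bracket (u v w : KillingField) :
    ⁅u, ⁅v, w⁆⁆ = (4 * form u v) • w - (4 * form u w) • v := by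
  apply KillingField.ext_entries <;>
  simp only [form_eq, bracket_zero_zero, bracket_zero_one, bracket_one_zero,
    sub_entry, smul_entry] <;>
  ring

/-! ### Points of the closed disc -/

theorem IsFutureCausal.entries {x : KillingField} (hx : IsFutureCausal x) :
    x.1 0 0 ^ 2 + x.1 0 1 * x.1 1 0 ≤ 0 ∧ x.1 0 1 ≤ 0 ∧ 0 ≤ x.1 1 0 ∧ x.1 0 1 < x.1 1 0 := by
  obtain ⟨h1, h2⟩ := hx
  rw [form_eq] at h1
  have h3 : x.1 0 1 * x.1 1 0 ≤ 0 := by nlinarith [sq_nonneg (x.1 0 0)]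
  have h4 : x.1 0 1 < x.1 1 0 := by linarith
  refine ⟨by linarith, ?_, ?_, h4⟩
  · by_contra! h
    nlinarith
  · by_contra! h
    nlinarith

/-- Reverse Cauchy–Schwarz: the diagonal contribution is dominated by the off-diagonal one, by AM–GM
applied to the two causality inequalities. -/
theorem IsFutureCausal.form_nonpos {x y : KillingField} (hx : IsFutureCausal x)
    (hy : IsFutureCausal y) : form x y ≤ 0 := by
  obtain ⟨h1, h2, h3, -⟩ := hx.entries
  obtain ⟨k1, k2, k3, -⟩ := hy.entries
  rw [form_eq]
  have e1 : 0 ≤ -(x.1 0 1 * y.1 1 0) := by nlinarith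
  have e2 : 0 ≤ -(x.1 1 0 * y.1 0 1) := by nlinarith
  have e3 : (2 * (x.1 0 0 * y.1 0 0)) ^ 2 ≤
      (-(x.1 0 1 * y.1 1 0) + -(x.1 1 0 * y.1 0 1)) ^ 2 := by
    have : x.1 0 0 ^ 2 * y.1 0 0 ^ 2 ≤ (-(x.1 0 1 * x.1 1 0)) * (-(y.1 0 1 * y.1 1 0)) :=
      mul_le_mul (by linarith) (by linarith) (sq_nonneg _) (by nlinarith)
    nlinarith [sq_nonneg (x.1 0 1 * y.1 1 0 - x.1 1 0 * y.1 0 1)]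
  have e4 := abs_le_of_sq_le_sq' e3 (by linarith)
  linarith [e4.2]

theorem IsFutureCausal.add {x y : KillingField} (hx : IsFutureCausal x)
    (hy : IsFutureCausal y) : IsFutureCausal (x + y) := by
  refine ⟨?_, ?_⟩
  · have := hx.form_nonpos hy
    rw [form_add_left, form_add_right, form_add_right, form_comm y x]
    linarith [hx.1, hy.1]
  · have h1 := hx.2
    have h2 := hy.2
    simp only [add_entry]
    linarith

theorem IsFutureCausal.smul {x : KillingField} (hx : IsFutureCausal x) {s : ℝ} (hs : 0 < s) :
    IsFutureCausal (s • x) := by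
  refine ⟨?_, ?_⟩
  · rw [form_smul_left, form_smul_right]
    nlinarith [hx.1, mul_pos hs hs]
  · have h1 := mul_pos hs hx.2
    simp only [smul_entry]
    linarith

/-- Orthogonal causal vectors are proportional. -/
theorem IsFutureCausal.exists_smul_eq {x y : KillingField} (hx : IsFutureCausal x)
    (hy : IsFutureCausal y) (hxy : form x y = 0) : ∃ s : ℝ, y = s • x := by
  obtain ⟨h1, h2, h3, h4⟩ := hx.entries
  obtain ⟨k1, k2, k3, k4⟩ := hy.entries
  rw [form_eq] at hxy
  rcases h3.eq_or_lt with h | h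
  · have ha : x.1 0 0 = 0 := by
      rw [← h] at h1
      nlinarith
    have hb : x.1 0 1 < 0 := by linarith
    have hc : y.1 1 0 = 0 := by
      rw [ha, ← h] at hxy
      have : x.1 0 1 * y.1 1 0 = 0 := by linarith
      exact (mul_eq_zero.1 this).resolve_left hb.ne
    have ha' : y.1 0 0 = 0 := by
      rw [hc] at k1
      nlinarith
    refine ⟨y.1 0 1 / x.1 0 1, KillingField.ext_entries ?_ ?_ ?_⟩ <;>
      simp [smul_entry, ha, ha', hc, ← h, hb.ne]
  · set l := y.1 1 0 / x.1 1 0 with hl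
    have hc : y.1 1 0 = l * x.1 1 0 := by rw [hl]; field_simp
    have hl0 : 0 ≤ l := div_nonneg k3 h.le
    have ha : y.1 0 0 = l * x.1 0 0 := by
      -- Weighting the two causality inequalities by the squared lower-left entries and using
      -- orthogonality leaves a perfect square, which must vanish.
      have e : (x.1 0 0 * y.1 1 0 - y.1 0 0 * x.1 1 0) ^ 2 ≤ 0 := by
        have e1 := mul_le_mul_of_nonneg_right h1 (sq_nonneg (y.1 1 0))
        have e2 := mul_le_mul_of_nonneg_right k1 (sq_nonneg (x.1 1 0))
        have e3 : (x.1 1 0 * y.1 1 0) * (2 * (x.1 0 0 * y.1 0 0) + x.1 0 1 * y.1 1 0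
          + x.1 1 0 * y.1 0 1) = 0 := by
          rw [show 2 * (x.1 0 0 * y.1 0 0) + x.1 0 1 * y.1 1 0 + x.1 1 0 * y.1 0 1 = 0 by linarith,
            mul_zero]
        nlinarith
      have e' : x.1 0 0 * y.1 1 0 - y.1 0 0 * x.1 1 0 = 0 := by nlinarith
      rw [hc] at e'
      have : x.1 1 0 * (y.1 0 0 - l * x.1 0 0) = 0 := by linarith
      have := (mul_eq_zero.1 this).resolve_left h.ne'
      linarith
    have hlpos : 0 < l := by
      rcases hl0.eq_or_lt with h0 | h0
      · rw [← h0] at ha hc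
        rw [ha, hc] at hxy
        have : x.1 1 0 * y.1 0 1 = 0 := by linarith
        have := (mul_eq_zero.1 this).resolve_left h.ne'
        linarith
      · exact h0
    have e1 : l * (2 * x.1 0 0 ^ 2 + x.1 0 1 * x.1 1 0) = - (x.1 1 0 * y.1 0 1) := by
      rw [ha, hc] at hxy
      linarith
    have e2 : l * (x.1 0 0 ^ 2 * l + x.1 1 0 * y.1 0 1) ≤ 0 := by
      rw [ha, hc] at k1
      linarith
    have e3 : x.1 0 0 ^ 2 * l + x.1 1 0 * y.1 0 1 ≤ 0 := by
      by_contra! hh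
      nlinarith
    have e4 : l * (x.1 0 0 ^ 2 + x.1 0 1 * x.1 1 0) = 0 := by
      apply le_antisymm <;> nlinarith
    have e5 := (mul_eq_zero.1 e4).resolve_left hlpos.ne'
    refine ⟨l, KillingField.ext_entries ?_ ?_ ?_⟩
    · simpa [smul_entry] using ha
    · simp only [smul_entry]
      have : x.1 1 0 * (y.1 0 1 - l * x.1 0 1) = 0 := by nlinarith
      have := (mul_eq_zero.1 this).resolve_left h.ne'
      linarith
    · simpa [smul_entry] using hc

theorem hyp_zero_zero (z : ℍ) : (hyp z).1 0 0 = z.re / z.im := by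
  simp [hyp]; ring
theorem hyp_zero_one (z : ℍ) : (hyp z).1 0 1 = -(z.re ^ 2 + z.im ^ 2) / z.im := by
  simp [hyp]; ring
theorem hyp_one_zero (z : ℍ) : (hyp z).1 1 0 = 1 / z.im := by
  simp [hyp]

theorem form_hyp_self (z : ℍ) : form (hyp z) (hyp z) = -1 := by
  have := z.im_pos.ne'
  rw [form_eq, hyp_zero_zero, hyp_zero_one, hyp_one_zero]
  field_simp
  ring

theorem isFutureCausal_hyp (z : ℍ) : IsFutureCausal (hyp z) := by
  refine ⟨by rw [form_hyp_self]; norm_num, ?_⟩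
  have := z.im_pos
  rw [hyp_zero_one, hyp_one_zero]
  have e : (1 / z.im - -(z.re ^ 2 + z.im ^ 2) / z.im) / 2
    = (1 + z.re ^ 2 + z.im ^ 2) / z.im / 2 := by ring
  rw [e]
  positivity

theorem IsFutureCausal.form_hyp_neg {x : KillingField} (hx : IsFutureCausal x) (z : ℍ) :
    form x (hyp z) < 0 := by
  refine lt_of_le_of_ne (hx.form_nonpos (isFutureCausal_hyp z)) fun h => ?_
  rw [form_comm] at h
  obtain ⟨s, rfl⟩ := (isFutureCausal_hyp z).exists_smul_eq hx h
  rw [form_smul_right, form_hyp_self] at h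
  obtain rfl : s = 0 := by linarith
  simpa using hx.2

/-- Timelike future vectors represent the points of `ℍ`. -/
theorem IsFutureCausal.exists_eq_smul_hyp {x : KillingField} (hx : IsFutureCausal x)
    (h : form x x < 0) : ∃ s : ℝ, 0 < s ∧ ∃ z : ℍ, x = s • hyp z := by
  obtain ⟨h1, h2, h3, h4⟩ := hx.entries
  rw [form_eq] at h
  have hc : 0 < x.1 1 0 := by
    rcases h3.eq_or_lt with h0 | h0
    · rw [← h0] at h
      nlinarith [sq_nonneg (x.1 0 0)]
    · exact h0
  have hd : 0 < -(x.1 0 0 ^ 2 + x.1 0 1 * x.1 1 0) := by linarith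
  set d := √(-(x.1 0 0 ^ 2 + x.1 0 1 * x.1 1 0)) with hdd
  have hdpos : 0 < d := Real.sqrt_pos.2 hd
  have hd2 : d ^ 2 = -(x.1 0 0 ^ 2 + x.1 0 1 * x.1 1 0) := Real.sq_sqrt hd.le
  refine ⟨d, hdpos, ⟨⟨x.1 0 0 / x.1 1 0, d / x.1 1 0⟩, div_pos hdpos hc⟩, ?_⟩
  apply KillingField.ext_entries <;>
    simp only [smul_entry, hyp_zero_zero,
      hyp_zero_one, hyp_one_zero, UpperHalfPlane.re, UpperHalfPlane.im]
  · field_simp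
  · field_simp
    rw [hd2]
    ring
  · field_simp

/-! ### Infinitesimal translations -/

/-- The two values `⁅ψ, hyp p⁆ = w • n` and `⁅ψ, n⁆ = w • hyp p` force `4 ψ = w ⁅hyp p, n⁆`, and the
triple product identity expands the action. With `x` and `y` on opposite sides of `n`, the sign of
each term can be read off. -/
theorem IsInfinitesimalTranslation.form_bracket_eq {ψ n : KillingField} {p : ℍ} {w : ℝ}
    (h : IsInfinitesimalTranslation ψ p n w) (hw : 0 < w) (x y : KillingField) :
    form ⁅ψ, x⁆ y = w * (form x n * form (hyp p) y - form x (hyp p) * form n y) := by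
  have h0 : ⁅ψ, hyp p⁆ = w • n := by simpa using h 0
  -- Any `t ≠ 0` would do: subtract `cosh t` times the case `t = 0` and divide by `sinh t`.
  have h1 : ⁅ψ, n⁆ = w • hyp p := by
    have := h 1
    rw [lie_add, lie_smul, lie_smul, h0, smul_add, smul_smul, smul_smul, smul_smul, add_comm,
      mul_comm w, mul_comm w, add_left_inj, ← smul_smul] at this
    exact smul_right_injective _ (Real.sinh_pos_iff.2 one_pos).ne' this
  have h2 : form (hyp p) ψ = 0 := by
    have := form_bracket_self ψ n
    rw [h1, form_smul_left] at this
    exact (mul_eq_zero.1 this).resolve_left hw.ne'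
  have h3 : (4 : ℝ) • ψ = w • ⁅hyp p, n⁆ := by
    have := bracket_bracket (hyp p) ψ (hyp p)
    rw [h0, h2, form_hyp_self, lie_smul] at this
    rw [this]
    simp
  have h4 : (4 : ℝ) • ⁅ψ, x⁆ = w • ⁅⁅hyp p, n⁆, x⁆ := by
    rw [← smul_lie, h3, smul_lie]
  have h5 : 4 * form ⁅ψ, x⁆ y = w * form ⁅⁅hyp p, n⁆, x⁆ y := by
    rw [← form_smul_left, h4, form_smul_left]
  rw [show ⁅⁅hyp p, n⁆, x⁆ = -⁅x, ⁅hyp p, n⁆⁆ from (lie_skew _ _).symm, form_neg_left, bracket_bracket, form_sub_left, form_smul_left,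
    form_smul_left] at h5
  linear_combination h5 / 4

/-! ### Crooked halfspaces -/

theorem continuous_entry (i j : Fin 2) : Continuous fun v : KillingField => v.1 i j :=
  (continuous_apply_apply i j).comp continuous_subtype_val

theorem continuous_ofEntries {X : Type*} [TopologicalSpace X] {a b c : X → ℝ}
    (ha : Continuous a) (hb : Continuous b) (hc : Continuous c) :
    Continuous fun x => ofEntries (a x) (b x) (c x) := by
  refine Continuous.subtype_mk (continuous_matrix fun i j => ?_) _
  fin_cases i <;> fin_cases j
  · exact ha
  · exact hb
  · exact hc
  · exact ha.neg

/-- A normalized causal vector. -/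
def discVector (q : ℝ × ℝ) : KillingField := ofEntries q.1 (q.2 - 1) (q.2 + 1)

theorem continuous_discVector : Continuous discVector := by
  unfold discVector
  exact continuous_ofEntries (by fun_prop) (by fun_prop) (by fun_prop)

theorem isFutureCausal_discVector {q : ℝ × ℝ} :
    IsFutureCausal (discVector q) ↔ q.1 ^ 2 + q.2 ^ 2 ≤ 1 := by
  simp only [IsFutureCausal, form_eq, discVector, ofEntries_zero_zero, ofEntries_zero_one,
    ofEntries_one_zero]
  constructor
  · rintro ⟨h, -⟩
    nlinarith
  · intro h
    constructor <;> nlinarith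

theorem IsFutureCausal.exists_discVector {x : KillingField} (hx : IsFutureCausal x) :
    ∃ s : ℝ, 0 < s ∧ ∃ q, discVector q = s • x := by
  have h := hx.2
  refine ⟨((x.1 1 0 - x.1 0 1) / 2)⁻¹, inv_pos.2 h,
    (((x.1 1 0 - x.1 0 1) / 2)⁻¹ * x.1 0 0,
      ((x.1 1 0 - x.1 0 1) / 2)⁻¹ * ((x.1 1 0 + x.1 0 1) / 2)), ?_⟩
  have h' : x.1 1 0 - x.1 0 1 ≠ 0 := by linarith
  apply KillingField.ext_entries <;>
    simp only [discVector, smul_entry,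
      ofEntries_zero_zero, ofEntries_zero_one, ofEntries_one_zero] <;>
    field_simp <;> ring

/-- The multiplier of `⁅w, ·⁆` on a fixed point, read off on the normalized causal vector. -/
noncomputable def multiplier (w : KillingField) (q : ℝ × ℝ) : ℝ :=
  (⁅w, discVector q⁆.1 1 0 - ⁅w, discVector q⁆.1 0 1) / 2

theorem continuous_bracket_entries (v : KillingField) :
    (Continuous fun a : KillingField × (ℝ × ℝ) => ⁅a.1 - v, discVector a.2⁆.1 0 0) ∧
    (Continuous fun a : KillingField × (ℝ × ℝ) => ⁅a.1 - v, discVector a.2⁆.1 0 1) ∧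
    (Continuous fun a : KillingField × (ℝ × ℝ) => ⁅a.1 - v, discVector a.2⁆.1 1 0) := by
  have h1 : ∀ i j, Continuous fun a : KillingField × (ℝ × ℝ) => (a.1 - v).1 i j := by
    intro i j
    simp only [sub_entry]
    exact ((continuous_entry i j).comp continuous_fst).sub continuous_const
  have h2 : ∀ i j, Continuous fun a : KillingField × (ℝ × ℝ) => (discVector a.2).1 i j :=
    fun i j => (continuous_entry i j).comp (continuous_discVector.comp continuous_snd)
  simp only [bracket_zero_zero, bracket_zero_one, bracket_one_zero]
  exact ⟨((h1 0 1).mul (h2 1 0)).sub ((h2 0 1).mul (h1 1 0)),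
    continuous_const.mul (((h1 0 0).mul (h2 0 1)).sub ((h2 0 0).mul (h1 0 1))),
    continuous_const.mul (((h1 1 0).mul (h2 0 0)).sub ((h2 1 0).mul (h1 0 0)))⟩

theorem isNonAttractingFixedPoint_discVector {w : KillingField} {q : ℝ × ℝ} :
    IsNonAttractingFixedPoint w (discVector q) ↔
      multiplier w q ≤ 0 ∧ ⁅w, discVector q⁆ = multiplier w q • discVector q := by
  constructor
  · rintro ⟨c, hc, h⟩
    have : multiplier w q = c := by
      rw [multiplier, h]
      simp only [discVector, smul_entry,
        ofEntries_zero_one, ofEntries_one_zero]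
      ring
    rw [this]
    exact ⟨hc, h⟩
  · rintro ⟨h1, h2⟩
    exact ⟨_, h1, h2⟩

theorem mem_CH_iff {v n w : KillingField} :
    w ∈ CH v n ↔ ∃ q : ℝ × ℝ, q.1 ^ 2 + q.2 ^ 2 ≤ 1 ∧ 0 ≤ form (discVector q) n ∧
      multiplier (w - v) q ≤ 0 ∧
      ⁅w - v, discVector q⁆ = multiplier (w - v) q • discVector q := by
  constructor
  · rintro ⟨x, hx, hn, c, hc, h⟩
    obtain ⟨s, hs, q, hq⟩ := hx.exists_discVector
    refine ⟨q, ?_, ?_, isNonAttractingFixedPoint_discVector.1 ⟨c, hc, ?_⟩⟩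
    · rw [← isFutureCausal_discVector, hq]
      exact hx.smul hs
    · rw [hq, form_smul_left]
      positivity
    · rw [hq, lie_smul, h, smul_comm]
  · rintro ⟨q, hq, hn, h⟩
    exact ⟨_, isFutureCausal_discVector.2 hq, hn, isNonAttractingFixedPoint_discVector.2 h⟩

/-- Rays of causal vectors are normalized to a compact disc, and the multiplier is a continuous
function of the field and the point. Hence the halfspace is the projection, along a compact factor,
of a closed set. -/
theorem isClosed_CH (v n : KillingField) : IsClosed (CH v n) := by
  obtain ⟨h00, h01, h10⟩ := continuous_bracket_entries v
  have hm : Continuous fun a : KillingField × (ℝ × ℝ) => multiplier (a.1 - v) a.2 :=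
    (h10.sub h01).div_const 2
  have hd : ∀ i j, Continuous fun a : KillingField × (ℝ × ℝ) => (discVector a.2).1 i j :=
    fun i j => (continuous_entry i j).comp (continuous_discVector.comp continuous_snd)
  have hK : IsCompact {q : ℝ × ℝ | q.1 ^ 2 + q.2 ^ 2 ≤ 1} := by
    refine IsCompact.of_isClosed_subset (isCompact_Icc.prod isCompact_Icc)
      (isClosed_le (by fun_prop) continuous_const)
      (?_ : _ ⊆ Icc (-1 : ℝ) 1 ×ˢ Icc (-1 : ℝ) 1)
    rintro ⟨a, b⟩ (h : a ^ 2 + b ^ 2 ≤ 1)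
    exact ⟨⟨by nlinarith, by nlinarith⟩, ⟨by nlinarith, by nlinarith⟩⟩
  have hcl : IsClosed {a : KillingField × (ℝ × ℝ) | 0 ≤ form (discVector a.2) n ∧
      multiplier (a.1 - v) a.2 ≤ 0 ∧
      ⁅a.1 - v, discVector a.2⁆.1 0 0 = multiplier (a.1 - v) a.2 * (discVector a.2).1 0 0 ∧
      ⁅a.1 - v, discVector a.2⁆.1 0 1 = multiplier (a.1 - v) a.2 * (discVector a.2).1 0 1 ∧
      ⁅a.1 - v, discVector a.2⁆.1 1 0 = multiplier (a.1 - v) a.2 * (discVector a.2).1 1 0} := by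
    have hf : Continuous fun a : KillingField × (ℝ × ℝ) => form (discVector a.2) n := by
      simp only [form_eq]
      exact ((hd 0 0).mul continuous_const).add ((((hd 0 1).mul continuous_const).add
        ((hd 1 0).mul continuous_const)).div_const 2)
    simp only [Set.ofPred_and]
    exact IsClosed.inter (isClosed_le continuous_const hf) (IsClosed.inter
      (isClosed_le hm continuous_const) (IsClosed.inter (isClosed_eq h00 (hm.mul (hd 0 0)))
      (IsClosed.inter (isClosed_eq h01 (hm.mul (hd 0 1)))
      (isClosed_eq h10 (hm.mul (hd 1 0))))))
  have := isCompact_iff_compactSpace.1 hK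
  have key := isClosedMap_fst_of_compactSpace (X := KillingField)
    (Y := {q : ℝ × ℝ | q.1 ^ 2 + q.2 ^ 2 ≤ 1}) _
    (hcl.preimage (continuous_id.prodMap continuous_subtype_val))
  convert key using 1
  ext w
  rw [mem_CH_iff]
  constructor
  · rintro ⟨q, hq, h1, h2, h3⟩
    refine ⟨(w, ⟨q, hq⟩), ⟨h1, h2, ?_, ?_, ?_⟩, rfl⟩ <;>
    · change ⁅w - v, discVector q⁆.1 _ _ = _
      rw [h3]
      rfl
  · rintro ⟨⟨w, q⟩, ⟨h1, h2, h3, h4, h5⟩, rfl⟩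
    exact ⟨q, q.2, h1, h2, KillingField.ext_entries h3 h4 h5⟩

/-- Every Killing field has a non-attracting fixed point in the closed disc. -/
theorem exists_isNonAttractingFixedPoint (w : KillingField) :
    ∃ x, IsFutureCausal x ∧ IsNonAttractingFixedPoint w x := by
  have hform := form_eq w w
  rcases lt_or_ge (form w w) 0 with hneg | hpos
  -- Elliptic case: the fixed point is the ray of `w` itself, up to sign.
  · have hne : w.1 1 0 - w.1 0 1 ≠ 0 := by
      intro h
      have : w.1 1 0 = w.1 0 1 := by linarith
      rw [this] at hform
      nlinarith [mul_self_nonneg (w.1 0 0), mul_self_nonneg (w.1 0 1)]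
    rcases lt_or_gt_of_ne hne with h | h
    · refine ⟨-w, ⟨?_, ?_⟩, 0, le_rfl, by simp⟩
      · rw [form_neg_left, form_neg_right, neg_neg]
        exact hneg.le
      · simp only [neg_entry]
        linarith
    · exact ⟨w, ⟨hneg.le, by linarith⟩, 0, le_rfl, by simp⟩
  · have null : ∀ u₁ u₂ : ℝ, 0 < u₁ ^ 2 + u₂ ^ 2 →
        IsFutureCausal (ofEntries (u₁ * u₂) (-u₁ ^ 2) (u₂ ^ 2)) := by
      intro u₁ u₂ h
      constructor
      · rw [form_eq]
        simp only [ofEntries_zero_zero, ofEntries_zero_one, ofEntries_one_zero]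
        nlinarith
      · simp only [ofEntries_zero_one, ofEntries_one_zero]
        linarith
    set d := √(form w w) with hd
    have hd2 : d ^ 2 = form w w := Real.sq_sqrt hpos
    have hd0 : 0 ≤ d := Real.sqrt_nonneg _
    -- An eigenvector `u` of `w` for the eigenvalue `-d` gives the null vector `u uᵀ J`, on which
    -- `⁅w, ·⁆` acts by `-2 d ≤ 0`: the repelling endpoint if `d > 0`.
    have eigen : ∀ u₁ u₂ : ℝ, (w.1 0 0 + d) * u₁ + w.1 0 1 * u₂ = 0 →
        w.1 1 0 * u₁ + (d - w.1 0 0) * u₂ = 0 →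
        IsNonAttractingFixedPoint w (ofEntries (u₁ * u₂) (-u₁ ^ 2) (u₂ ^ 2)) := by
      intro u₁ u₂ h1 h2
      refine ⟨-2 * d, by linarith, KillingField.ext_entries ?_ ?_ ?_⟩ <;>
      simp only [bracket_zero_zero, bracket_zero_one, bracket_one_zero, smul_entry, ofEntries_zero_zero, ofEntries_zero_one,
        ofEntries_one_zero]
      · linear_combination u₂ * h1 + u₁ * h2
      · linear_combination (-2 * u₁) * h1
      · linear_combination (2 * u₂) * h2
    -- Each row of `w + d` is annihilated by an explicit vector, which is in the kernel because the
    -- determinant vanishes. If both vectors are zero then `w = 0` and any `u` works.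
    by_cases hu : 0 < (w.1 0 1) ^ 2 + (-(w.1 0 0 + d)) ^ 2
    · refine ⟨_, null _ _ hu, eigen _ _ (by ring) ?_⟩
      linear_combination -hform - hd2
    by_cases hv : 0 < (w.1 0 0 - d) ^ 2 + (w.1 1 0) ^ 2
    · refine ⟨_, null _ _ hv, eigen _ _ ?_ (by ring)⟩
      linear_combination -hform - hd2
    · have e1 : w.1 0 1 = 0 := by nlinarith [sq_nonneg (w.1 0 1), sq_nonneg (w.1 0 0 + d)]
      have e2 : w.1 1 0 = 0 := by nlinarith [sq_nonneg (w.1 1 0), sq_nonneg (w.1 0 0 - d)]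
      have e3 : w.1 0 0 + d = 0 := by nlinarith [sq_nonneg (w.1 0 1), sq_nonneg (w.1 0 0 + d)]
      have e4 : w.1 0 0 - d = 0 := by nlinarith [sq_nonneg (w.1 1 0), sq_nonneg (w.1 0 0 - d)]
      refine ⟨_, null 1 0 (by norm_num), eigen _ _ ?_ ?_⟩
      · linarith
      · linarith

theorem compl_CH_neg_subset_interior_CH (v n : KillingField) :
    (CH v (-n))ᶜ ⊆ interior (CH v n) := by
  refine interior_maximal (fun w hw => ?_) (isClosed_CH v (-n)).isOpen_compl
  obtain ⟨x, hx, hfix⟩ := exists_isNonAttractingFixedPoint (w - v)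
  refine ⟨x, hx, ?_, hfix⟩
  by_contra! h
  exact hw ⟨x, hx, by rw [form_neg_right]; linarith, hfix⟩

/-! ### Geodesics, half planes and chords -/

/-- The function `2 y (hyp z · n)`, which is affine in the Klein model. -/
noncomputable def level (n : KillingField) (z : ℍ) : ℝ :=
  2 * n.1 0 0 * z.re - n.1 1 0 * (z.re ^ 2 + z.im ^ 2) + n.1 0 1

theorem form_hyp_eq (n : KillingField) (z : ℍ) : form (hyp z) n = level n z / (2 * z.im) := by
  have := z.im_pos.ne'
  rw [form_eq, hyp_zero_zero, hyp_zero_one, hyp_one_zero, level]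
  field_simp
  ring

theorem mem_geodesic_iff {n : KillingField} {z : ℍ} : z ∈ geodesic n ↔ level n z = 0 := by
  have := z.im_pos.ne'
  change form (hyp z) n = 0 ↔ _
  rw [form_hyp_eq]
  simp [this]

theorem mem_halfPlane_iff {n : KillingField} {z : ℍ} : z ∈ halfPlane n ↔ 0 < level n z := by
  have := z.im_pos
  change 0 < form (hyp z) n ↔ _
  rw [form_hyp_eq, div_pos_iff_of_pos_right (by positivity)]

theorem form_hyp_neg_iff {n : KillingField} {z : ℍ} : form (hyp z) n < 0 ↔ level n z < 0 := by
  have := z.im_pos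
  rw [form_hyp_eq, div_lt_iff₀ (by positivity), zero_mul]

theorem level_neg (n : KillingField) (z : ℍ) : level (-n) z = -level n z := by
  simp only [level, neg_entry]
  ring

theorem geodesic_neg (n : KillingField) : geodesic (-n) = geodesic n := by
  ext z
  rw [mem_geodesic_iff, mem_geodesic_iff, level_neg, neg_eq_zero]

theorem IsUnitSpacelike.neg {n : KillingField} (hn : IsUnitSpacelike n) :
    IsUnitSpacelike (-n) := by
  rw [IsUnitSpacelike, form_neg_left, form_neg_right, neg_neg]
  exact hn

theorem continuous_level (n : KillingField) : Continuous (level n) := by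
  unfold level
  have h1 := UpperHalfPlane.continuous_re
  have h2 := UpperHalfPlane.continuous_im
  fun_prop

theorem isClosed_geodesic (n : KillingField) : IsClosed (geodesic n) := by
  have : geodesic n = level n ⁻¹' {0} := by
    ext z
    exact mem_geodesic_iff
  rw [this]
  exact isClosed_singleton.preimage (continuous_level n)

theorem IsUnitSpacelike.entries {n : KillingField} (hn : IsUnitSpacelike n) :
    n.1 0 0 ^ 2 + n.1 0 1 * n.1 1 0 = 1 := by
  rw [IsUnitSpacelike, form_eq] at hn
  linarith

theorem IsUnitSpacelike.geodesic_nonempty {n : KillingField} (hn : IsUnitSpacelike n) :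
    (geodesic n).Nonempty := by
  have h := hn.entries
  by_cases hc : n.1 1 0 = 0
  · rw [hc] at h
    have ha : n.1 0 0 ≠ 0 := by
      intro h0
      rw [h0] at h
      norm_num at h
    refine ⟨⟨⟨-n.1 0 1 / (2 * n.1 0 0), 1⟩, one_pos⟩, mem_geodesic_iff.2 ?_⟩
    simp only [level, hc, UpperHalfPlane.re, UpperHalfPlane.im]
    field_simp
    ring
  · refine ⟨⟨⟨n.1 0 0 / n.1 1 0, 1 / |n.1 1 0|⟩, by simpa using hc⟩, mem_geodesic_iff.2 ?_⟩
    simp only [level, UpperHalfPlane.re, UpperHalfPlane.im]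
    rw [div_pow 1, sq_abs]
    field_simp
    linear_combination h

theorem IsUnitSpacelike.halfPlane_nonempty {n : KillingField} (hn : IsUnitSpacelike n) :
    (halfPlane n).Nonempty := by
  have h := hn.entries
  rcases lt_trichotomy (n.1 1 0) 0 with hc | hc | hc
  · refine ⟨⟨⟨n.1 0 0 / n.1 1 0, -2 / n.1 1 0⟩, div_pos_of_neg_of_neg (by norm_num) hc⟩,
      mem_halfPlane_iff.2 ?_⟩
    simp only [level, UpperHalfPlane.re, UpperHalfPlane.im]
    have e : 2 * n.1 0 0 * (n.1 0 0 / n.1 1 0) - n.1 1 0 * ((n.1 0 0 / n.1 1 0) ^ 2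
      + (-2 / n.1 1 0) ^ 2) + n.1 0 1 = -3 / n.1 1 0 := by
      have := hc.ne
      field_simp
      linear_combination h
    rw [e]
    exact div_pos_of_neg_of_neg (by norm_num) hc
  · rw [hc] at h
    have ha : n.1 0 0 ≠ 0 := by
      intro h0
      rw [h0] at h
      norm_num at h
    refine ⟨⟨⟨(1 - n.1 0 1) / (2 * n.1 0 0), 1⟩, one_pos⟩, mem_halfPlane_iff.2 ?_⟩
    simp only [level, hc, UpperHalfPlane.re, UpperHalfPlane.im]
    have e : 2 * n.1 0 0 * ((1 - n.1 0 1) / (2 * n.1 0 0)) = 1 - n.1 0 1 := by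
      field_simp
    rw [e]
    norm_num
  · refine ⟨⟨⟨n.1 0 0 / n.1 1 0, 1 / (2 * n.1 1 0)⟩, by positivity⟩,
      mem_halfPlane_iff.2 ?_⟩
    simp only [level, UpperHalfPlane.re, UpperHalfPlane.im]
    have e : 2 * n.1 0 0 * (n.1 0 0 / n.1 1 0) - n.1 1 0 * ((n.1 0 0 / n.1 1 0) ^ 2
      + (1 / (2 * n.1 1 0)) ^ 2) + n.1 0 1 = 3 / (4 * n.1 1 0) := by
      field_simp
      linear_combination 16 * h
    rw [e]
    positivity

theorem chord_pos (z z' : ℍ) (t : unitInterval) :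
    0 < (1 - (t : ℝ)) * (z.re ^ 2 + z.im ^ 2) + t * (z'.re ^ 2 + z'.im ^ 2)
      - ((1 - (t : ℝ)) * z.re + t * z'.re) ^ 2 := by
  have h0 := t.2.1
  have h1 := t.2.2
  have hy := mul_pos z.im_pos z.im_pos
  have hy' := mul_pos z'.im_pos z'.im_pos
  have e : (1 - (t : ℝ)) * (z.re ^ 2 + z.im ^ 2) + t * (z'.re ^ 2 + z'.im ^ 2)
      - ((1 - (t : ℝ)) * z.re + t * z'.re) ^ 2 =
      (1 - (t : ℝ)) * (z.im * z.im) + t * (z'.im * z'.im)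
        + (1 - (t : ℝ)) * t * (z.re - z'.re) ^ 2 := by ring
  rw [e]
  have e1 : 0 ≤ (1 - (t : ℝ)) * t * (z.re - z'.re) ^ 2 :=
    mul_nonneg (mul_nonneg (by linarith) h0) (sq_nonneg _)
  rcases h0.eq_or_lt with h | h
  · rw [← h] at *
    linarith
  · have := mul_pos h hy'
    have := mul_nonneg (sub_nonneg.2 h1) hy.le
    linarith

/-- The hyperbolic segment from `z` to `z'`, parametrized affinely in the Klein model. -/
noncomputable def chord (z z' : ℍ) (t : unitInterval) : ℍ :=
  ⟨⟨(1 - (t : ℝ)) * z.re + t * z'.re,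
    √((1 - (t : ℝ)) * (z.re ^ 2 + z.im ^ 2) + t * (z'.re ^ 2 + z'.im ^ 2)
      - ((1 - (t : ℝ)) * z.re + t * z'.re) ^ 2)⟩, Real.sqrt_pos.2 (chord_pos z z' t)⟩

/-- `level n` is affine in `re` and `re ^ 2 + im ^ 2`, the two quantities that `chord` interpolates
linearly. -/
theorem level_chord (n : KillingField) (z z' : ℍ) (t : unitInterval) :
    level n (chord z z' t) = (1 - (t : ℝ)) * level n z + t * level n z' := by
  have h : (chord z z' t).im ^ 2 = _ := Real.sq_sqrt (chord_pos z z' t).le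
  have h' : (chord z z' t).re = (1 - (t : ℝ)) * z.re + t * z'.re := rfl
  rw [level, h, h', level, level]
  ring

theorem continuous_chord (z z' : ℍ) : Continuous (chord z z') := by
  rw [UpperHalfPlane.isEmbedding_coe.continuous_iff]
  have : (fun w : ℍ => (w : ℂ)) ∘ chord z z' = fun t : unitInterval =>
      Complex.equivRealProdCLM.symm ((1 - (t : ℝ)) * z.re + t * z'.re,
      √((1 - (t : ℝ)) * (z.re ^ 2 + z.im ^ 2) + t * (z'.re ^ 2 + z'.im ^ 2)
        - ((1 - (t : ℝ)) * z.re + t * z'.re) ^ 2)) := by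
    funext t
    apply Complex.ext <;> simp [chord]
  rw [this]
  fun_prop

theorem chord_zero (z z' : ℍ) : chord z z' 0 = z := by
  apply UpperHalfPlane.ext
  apply Complex.ext
  · simp [chord]
  · simp [chord, Real.sqrt_sq z.im_pos.le]

theorem chord_one (z z' : ℍ) : chord z z' 1 = z' := by
  apply UpperHalfPlane.ext
  apply Complex.ext
  · simp [chord]
  · simp [chord, Real.sqrt_sq z'.im_pos.le]

/-- A chord between points on different sides of a geodesic crosses it. -/
theorem exists_chord_mem_geodesic {n : KillingField} {z z' : ℍ} (h : 0 < level n z)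
    (h' : level n z' ≤ 0) : ∃ t, chord z z' t ∈ geodesic n := by
  refine ⟨⟨level n z / (level n z - level n z'), div_nonneg h.le (by linarith),
    (div_le_one (by linarith)).2 (by linarith)⟩, ?_⟩
  rw [mem_geodesic_iff, level_chord]
  have : level n z - level n z' ≠ 0 := by linarith
  field_simp
  ring

theorem level_pos_iff_of_chord {n : KillingField} {z z' : ℍ}
    (h : ∀ t, chord z z' t ∉ geodesic n) : 0 < level n z ↔ 0 < level n z' := by
  have key : level (-n) z ≠ 0 := by
    intro h0
    rw [← mem_geodesic_iff, geodesic_neg] at h0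
    exact h 0 (by rwa [chord_zero])
  constructor
  · intro hz
    by_contra! hz'
    obtain ⟨t, ht⟩ := exists_chord_mem_geodesic hz hz'
    exact h t ht
  · intro hz'
    by_contra! hz
    have hz : 0 < level (-n) z := by
      refine lt_of_le_of_ne ?_ key.symm
      rw [level_neg]
      linarith
    obtain ⟨t, ht⟩ := exists_chord_mem_geodesic hz (z' := z') (by rw [level_neg]; linarith)
    rw [geodesic_neg] at ht
    exact h t ht

theorem level_chord_pos {n : KillingField} {z z' : ℍ} (h : 0 < level n z) (h' : 0 < level n z')
    (t : unitInterval) : 0 < level n (chord z z' t) := by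
  rw [level_chord]
  rcases t.2.1.eq_or_lt with h0 | h0
  · rw [← h0]
    linarith
  · have := mul_pos h0 h'
    have := mul_nonneg (sub_nonneg.2 t.2.2) h.le
    linarith

theorem chord_mem_geodesic {n : KillingField} {z z' : ℍ} (h : z ∈ geodesic n)
    (h' : z' ∈ geodesic n) (t : unitInterval) : chord z z' t ∈ geodesic n := by
  rw [mem_geodesic_iff] at *
  rw [level_chord, h, h']
  ring

/-- Two points on the same side of a geodesic are on the same side with respect to any unit vector
that defines the same geodesic. -/
theorem level_pos_iff_of_geodesic_eq {n m : KillingField} (hnm : geodesic m = geodesic n)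
    {z z' : ℍ} (h : 0 < level n z) (h' : 0 < level n z') : 0 < level m z ↔ 0 < level m z' := by
  refine level_pos_iff_of_chord fun t ht => ?_
  rw [hnm, mem_geodesic_iff] at ht
  exact (level_chord_pos h h' t).ne' ht

/-- All points of a geodesic are on the same side of a disjoint geodesic. -/
theorem level_pos_iff_of_disjoint {n m : KillingField} (hnm : Disjoint (geodesic n) (geodesic m))
    {p q : ℍ} (hp : p ∈ geodesic n) (hq : q ∈ geodesic n) : 0 < level m p ↔ 0 < level m q :=
  level_pos_iff_of_chord fun t => disjoint_left.1 hnm (chord_mem_geodesic hp hq t)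

/-- The dichotomy for disjoint geodesics. -/
theorem halfPlane_subset_or {n m : KillingField} (hnm : Disjoint (geodesic n) (geodesic m))
    (hm : (geodesic m).Nonempty) {p : ℍ} (hp : p ∈ geodesic n) (hpm : 0 < level m p) :
    halfPlane n ⊆ halfPlane m ∨ halfPlane (-n) ⊆ halfPlane m := by
  obtain ⟨q, hq⟩ := hm
  have aux : ∀ k : KillingField, geodesic k = geodesic n → level k q ≤ 0 →
      halfPlane k ⊆ halfPlane m := by
    -- The chord from `p` into `halfPlane k` stays on the nonnegative side of `k`, whereas `geodesic
    -- m` lies entirely on the other side, since `q` does.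
    intro k hk hqk z hz
    rw [mem_halfPlane_iff] at *
    rw [← hk] at hp hnm
    refine (level_pos_iff_of_chord fun t ht => ?_).1 hpm
    have h1 : 0 ≤ level k (chord p z t) := by
      rw [level_chord, mem_geodesic_iff.1 hp, mul_zero, zero_add]
      exact mul_nonneg t.2.1 hz.le
    rcases h1.eq_or_lt with h | h
    · exact disjoint_left.1 hnm (mem_geodesic_iff.2 h.symm) ht
    · have h2 := (level_pos_iff_of_disjoint hnm.symm ht hq (m := k)).1 h
      linarith
  rcases le_or_gt (level n q) 0 with h | h
  · exact Or.inl (aux n rfl h)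
  · exact Or.inr (aux (-n) (geodesic_neg n) (by rw [level_neg]; linarith))

/-- Inclusion of half planes extends to their closures in the closed disc. -/
theorem form_nonneg_of_halfPlane_subset {n m : KillingField} (hne : (halfPlane n).Nonempty)
    (hnm : halfPlane n ⊆ halfPlane m) {x : KillingField} (hx : IsFutureCausal x)
    (h : 0 ≤ form x n) : 0 ≤ form x m := by
  obtain ⟨z, hz⟩ := hne
  -- Pushing `x` towards an interior point `z` of the half plane gives a timelike vector, hence a
  -- genuine point of `halfPlane n`.
  have key : ∀ ε : ℝ, 0 < ε → 0 ≤ form x m + ε * form (hyp z) m := by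
    intro ε hε
    have hz' : 0 < form (hyp z) n := hz
    have h1 := hx.add ((isFutureCausal_hyp z).smul hε)
    have h2 : form (x + ε • hyp z) (x + ε • hyp z) < 0 := by
      simp only [form_add_left, form_add_right, form_smul_left, form_smul_right, form_hyp_self,
        form_comm (hyp z) x]
      have := mul_neg_of_pos_of_neg hε (hx.form_hyp_neg z)
      nlinarith [hx.1, mul_pos hε hε]
    obtain ⟨s, hs, y, hy⟩ := h1.exists_eq_smul_hyp h2
    have h3 : 0 < form (x + ε • hyp z) n := by
      rw [form_add_left, form_smul_left]
      have := mul_pos hε hz'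
      linarith
    rw [hy, form_smul_left] at h3
    have h4 : 0 < form (hyp y) m := hnm (pos_of_mul_pos_right h3 hs.le)
    have h5 := mul_pos hs h4
    rw [← form_smul_left, ← hy, form_add_left, form_smul_left] at h5
    exact h5.le
  by_contra! hneg
  have hz' : 0 < form (hyp z) m := hnm hz
  -- This `ε` makes the perturbation cancel only half of the negative value `form x m`.
  have := key (-form x m / (2 * form (hyp z) m)) (div_pos (by linarith) (by linarith))
  have e : -form x m / (2 * form (hyp z) m) * form (hyp z) m = -form x m / 2 := by
    field_simp
  rw [e] at this
  linarith

/-! ### The action of `PGL(2, ℝ)` on geodesics -/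

/-- The witness is `g⁻¹ n g` written out in entries; the sign of its transverse orientation is
irrelevant here. -/
theorem GL_smul_mem_geodesic (g : GL (Fin 2) ℝ) {n : KillingField} (hn : IsUnitSpacelike n) :
    ∃ m, IsUnitSpacelike m ∧ ∀ z : ℍ, g • z ∈ geodesic n ↔ z ∈ geodesic m := by
  have hd : g.1 0 0 * g.1 1 1 - g.1 0 1 * g.1 1 0 ≠ 0 := by
    have := g.det_ne_zero
    rwa [Matrix.det_fin_two] at this
  set a := g.1 0 0 with ha
  set b := g.1 0 1 with hb
  set c := g.1 1 0 with hc
  set d := g.1 1 1 with hdd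
  set D := a * d - b * c with hD
  have hn' := hn.entries
  refine ⟨ofEntries ((n.1 0 0 * (a * d + b * c) - n.1 1 0 * a * b + n.1 0 1 * c * d) / D)
    ((2 * n.1 0 0 * b * d - n.1 1 0 * b ^ 2 + n.1 0 1 * d ^ 2) / D)
    ((-2 * n.1 0 0 * a * c + n.1 1 0 * a ^ 2 - n.1 0 1 * c ^ 2) / D), ?_, fun z => ?_⟩
  · rw [IsUnitSpacelike, form_eq]
    simp only [ofEntries_zero_zero, ofEntries_zero_one, ofEntries_one_zero]
    field_simp
    rw [hD]
    linear_combination 2 * (a * d - b * c) ^ 2 * hn'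
  · have hden : Complex.normSq (UpperHalfPlane.denom g z) =
        (c * z.re + d) ^ 2 + (c * z.im) ^ 2 := by
      simp [UpperHalfPlane.denom, Complex.normSq_apply, hc, hdd, sq]
    have hnum : Complex.normSq (UpperHalfPlane.num g z) =
        (a * z.re + b) ^ 2 + (a * z.im) ^ 2 := by
      simp [UpperHalfPlane.num, Complex.normSq_apply, ha, hb, sq]
    have hN : 0 < (c * z.re + d) ^ 2 + (c * z.im) ^ 2 :=
      hden ▸ UpperHalfPlane.normSq_denom_pos g z.im_ne_zero
    have hre : (g • z).re * ((c * z.re + d) ^ 2 + (c * z.im) ^ 2) =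
        a * c * (z.re ^ 2 + z.im ^ 2) + (a * d + b * c) * z.re + b * d := by
      rw [UpperHalfPlane.re_smul, Complex.div_re, hden, ← add_div, div_mul_cancel₀ _ hN.ne']
      simp [UpperHalfPlane.num, UpperHalfPlane.denom, ← ha, ← hb, ← hc, ← hdd]
      ring
    have habs : ((g • z).re ^ 2 + (g • z).im ^ 2) * ((c * z.re + d) ^ 2 + (c * z.im) ^ 2) =
        (a * z.re + b) ^ 2 + (a * z.im) ^ 2 := by
      rw [UpperHalfPlane.re_smul, UpperHalfPlane.im_smul, sq_abs, sq, sq,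
        ← Complex.normSq_apply, Complex.normSq_div, hden, hnum, div_mul_cancel₀ _ hN.ne']
    rw [mem_geodesic_iff, mem_geodesic_iff]
    have e : level n (g • z) * ((c * z.re + d) ^ 2 + (c * z.im) ^ 2) = D *
        level (ofEntries ((n.1 0 0 * (a * d + b * c) - n.1 1 0 * a * b + n.1 0 1 * c * d) / D)
        ((2 * n.1 0 0 * b * d - n.1 1 0 * b ^ 2 + n.1 0 1 * d ^ 2) / D)
        ((-2 * n.1 0 0 * a * c + n.1 1 0 * a ^ 2 - n.1 0 1 * c ^ 2) / D)) z := by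
      simp only [level, ofEntries_zero_zero, ofEntries_zero_one, ofEntries_one_zero]
      field_simp
      linear_combination 2 * n.1 0 0 * hre - n.1 1 0 * habs
    constructor
    · intro h
      rw [h, zero_mul] at e
      exact (mul_eq_zero.1 e.symm).resolve_left hd
    · intro h
      rw [h, mul_zero] at e
      exact (mul_eq_zero.1 e).resolve_right hN.ne'

theorem exists_smul_geodesic_eq (g : PGL(2, ℝ)) {n : KillingField} (hn : IsUnitSpacelike n) :
    ∃ m, IsUnitSpacelike m ∧ g • geodesic n = geodesic m := by
  obtain ⟨h, hh⟩ := Matrix.ProjGenLinGroup.mk_surjective g⁻¹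
  obtain ⟨m, hm, hz⟩ := GL_smul_mem_geodesic h hn
  refine ⟨m, hm, ?_⟩
  ext z
  rw [← hz, mem_smul_set_iff_inv_smul_mem, ← hh, UpperHalfPlane.pglMk_smul]

/-! ### Lifted arcs and tiles -/

namespace ArcSystem

variable {Γ : Type*} [Group Γ] {ρ₀ : Γ →* PGL(2, ℝ)} {ι : Type*}

/-- `n` is a unit normal of a lifted arc. -/
def IsLift (A : ArcSystem ρ₀ ι) (n : KillingField) : Prop :=
  IsUnitSpacelike n ∧ geodesic n ∈ A.lifts

theorem IsLift.neg {A : ArcSystem ρ₀ ι} {n : KillingField} (hn : A.IsLift n) : A.IsLift (-n) :=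
  ⟨hn.1.neg, by rw [geodesic_neg]; exact hn.2⟩

theorem exists_isLift {A : ArcSystem ρ₀ ι} {L : Set ℍ} (hL : L ∈ A.lifts) :
    ∃ n, A.IsLift n ∧ L = geodesic n := by
  obtain ⟨γ, i, hL'⟩ := id hL
  obtain ⟨n, hn, hi⟩ := A.isGeodesic i
  obtain ⟨m, hm, h⟩ := exists_smul_geodesic_eq (ρ₀ γ) hn
  rw [← hi, ← hL'] at h
  exact ⟨m, ⟨hm, h ▸ hL⟩, h⟩

theorem proj_smul (γ : Γ) (z : ℍ) : proj ρ₀ (ρ₀ γ • z) = proj ρ₀ z :=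
  Quotient.sound ⟨⟨ρ₀ γ, γ, rfl⟩, rfl⟩

theorem continuous_proj : Continuous (proj ρ₀) := continuous_quotient_mk'

/-- A common point projects to a single arc; injectivity on that arc and freeness of the action then
identify the two group elements. -/
theorem disjoint_lifts (hρ₀ : IsSurfaceGroup ρ₀) (A : ArcSystem ρ₀ ι) {L L' : Set ℍ}
    (hL : L ∈ A.lifts) (hL' : L' ∈ A.lifts) (hne : L ≠ L') : Disjoint L L' := by
  obtain ⟨γ, i, rfl⟩ := hL
  obtain ⟨δ, j, rfl⟩ := hL'
  rw [Set.disjoint_left]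
  rintro _ ⟨a, ha, rfl⟩ ⟨b, hb, hab⟩
  have hab : ρ₀ δ • b = ρ₀ γ • a := hab
  have hproj : proj ρ₀ b = proj ρ₀ a := by
    rw [← proj_smul δ b, hab, proj_smul]
  have hij : i = j := by
    by_contra hij
    exact Set.disjoint_left.1 (A.disjoint i j hij) ⟨a, ha, rfl⟩ ⟨b, hb, hproj⟩
  subst hij
  obtain rfl := A.injective i hb ha hproj
  have hfix : ρ₀ (δ⁻¹ * γ) • b = b := by
    rw [map_mul, map_inv, mul_smul, ← hab, inv_smul_smul]
  have h1 : δ⁻¹ * γ = 1 := by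
    by_contra h
    exact hρ₀.free _ h b hfix
  exact hne (by rw [inv_mul_eq_one.1 h1])

/-- The family of lifted arcs is locally finite. -/
theorem finite_lifts_inter_compact (hρ₀ : IsSurfaceGroup ρ₀) [Finite ι] (A : ArcSystem ρ₀ ι)
    {K : Set ℍ} (hK : IsCompact K) : {L ∈ A.lifts | (L ∩ K).Nonempty}.Finite := by
  have := hρ₀.properlyDiscontinuous
  -- The part of `arc i` lying over the image of `K`, compact by properness; a translate of `arc i`
  -- meets `K` only if that translate of `C i` does.
  let C : ι → Set ℍ := fun i =>
    Subtype.val '' ((fun z : A.arc i => proj ρ₀ z) ⁻¹' (proj ρ₀ '' K))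
  have hC : ∀ i, IsCompact (C i) := fun i =>
    ((A.proper i).isCompact_preimage (hK.image continuous_proj)).image continuous_subtype_val
  have hfin : ∀ i, {g : ρ₀.range | ((g • ·) '' C i ∩ K).Nonempty}.Finite :=
    fun i => finite_disjoint_inter_image (hC i) hK
  refine (Set.finite_iUnion fun i => (hfin i).image
    fun g : ρ₀.range => (g : PGL(2, ℝ)) • A.arc i).subset ?_
  rintro L ⟨⟨γ, i, rfl⟩, _, ⟨a, ha, rfl⟩, haK⟩
  refine mem_iUnion.2 ⟨i, ⟨ρ₀ γ, γ, rfl⟩, ⟨ρ₀ γ • a, ⟨a, ⟨⟨a, ha⟩, ⟨_, haK, ?_⟩, rfl⟩, rfl⟩, haK⟩,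
    rfl⟩
  exact proj_smul γ a

theorem exists_isOpen_disjoint_lifts (hρ₀ : IsSurfaceGroup ρ₀) [Finite ι] (A : ArcSystem ρ₀ ι)
    {n : KillingField} (hn : A.IsLift n) {q : ℍ} (hq : q ∈ geodesic n) :
    ∃ W, IsOpen W ∧ q ∈ W ∧ ∀ L ∈ A.lifts, L ≠ geodesic n → Disjoint W L := by
  obtain ⟨K, hK, hqK⟩ := exists_compact_mem_nhds q
  have hfin := (A.finite_lifts_inter_compact hρ₀ hK).subset
    (sep_subset _ fun L => L ≠ geodesic n)
  refine ⟨interior K ∩ (⋃₀ {L ∈ {L ∈ A.lifts | (L ∩ K).Nonempty} | L ≠ geodesic n})ᶜ,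
    isOpen_interior.inter ?_, ⟨mem_interior_iff_mem_nhds.2 hqK, ?_⟩, ?_⟩
  · rw [isOpen_compl_iff, sUnion_eq_biUnion]
    refine hfin.isClosed_biUnion fun L hL => ?_
    obtain ⟨m, -, rfl⟩ := exists_isLift hL.1.1
    exact isClosed_geodesic m
  · rintro ⟨L, hL, hqL⟩
    exact Set.disjoint_left.1 (A.disjoint_lifts hρ₀ hL.1.1 hn.2 hL.2) hqL hq
  · intro L hL hne
    rw [Set.disjoint_left]
    rintro z ⟨hz, hz'⟩ hzL
    exact hz' ⟨L, ⟨⟨hL, z, hzL, interior_subset hz⟩, hne⟩, hzL⟩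

theorem level_ne_zero {A : ArcSystem ρ₀ ι} {n : KillingField} (hn : A.IsLift n) {z : ℍ}
    (hz : z ∈ (⋃₀ A.lifts)ᶜ) : level n z ≠ 0 :=
  fun h => hz ⟨_, hn.2, mem_geodesic_iff.2 h⟩

/-- Two points in the complement of the lifted arcs are in the same tile iff no lifted arc separates
them. -/
theorem mem_tile_iff {A : ArcSystem ρ₀ ι} {z z' : ℍ} (hz : z ∈ (⋃₀ A.lifts)ᶜ) :
    z' ∈ connectedComponentIn (⋃₀ A.lifts)ᶜ z ↔
      z' ∈ (⋃₀ A.lifts)ᶜ ∧ ∀ m, A.IsLift m → (0 < level m z' ↔ 0 < level m z) := by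
  constructor
  · intro h
    refine ⟨connectedComponentIn_subset _ _ h, ?_⟩
    -- A sign change of `level m` on a connected tile would produce a zero, i.e. a point of a lifted
    -- arc in the tile.
    have aux : ∀ m, A.IsLift m → ∀ x ∈ connectedComponentIn (⋃₀ A.lifts)ᶜ z,
        ∀ y ∈ connectedComponentIn (⋃₀ A.lifts)ᶜ z, 0 < level m x → 0 < level m y := by
      intro m hm x hx y hy hxm
      by_contra! hym
      obtain ⟨p, hp, hp0⟩ := isPreconnected_connectedComponentIn.intermediate_value hy hx
        (continuous_level m).continuousOn (show (0 : ℝ) ∈ _ from ⟨hym, hxm.le⟩)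
      exact level_ne_zero hm (connectedComponentIn_subset _ _ hp) hp0
    have hz' := mem_connectedComponentIn hz
    exact fun m hm => ⟨aux m hm _ h _ hz', aux m hm _ hz' _ h⟩
  · rintro ⟨hz', h⟩
    have hsub : range (chord z z') ⊆ (⋃₀ A.lifts)ᶜ := by
      rintro _ ⟨t, rfl⟩ ⟨L, hL, ht⟩
      obtain ⟨m, hm, rfl⟩ := exists_isLift hL
      have h0 := level_ne_zero hm hz
      have aux : ∀ k, A.IsLift k → geodesic k = geodesic m → 0 < level k z → False := by
        intro k hk hkm hpos
        rw [← hkm, mem_geodesic_iff] at ht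
        exact (level_chord_pos hpos ((h k hk).2 hpos) t).ne' ht
      rcases lt_or_gt_of_ne h0 with hneg | hpos
      · exact aux (-m) hm.neg (geodesic_neg m) (by rw [level_neg]; linarith)
      · exact aux m hm rfl hpos
    have hconn : IsPreconnected (range (chord z z')) :=
      (isPreconnected_range (continuous_chord z z'))
    exact hconn.subset_connectedComponentIn ⟨0, chord_zero z z'⟩ hsub ⟨1, chord_one z z'⟩

/-- The tile adjacent to the lifted arc `geodesic n` on its positive side. -/
def sideTile (A : ArcSystem ρ₀ ι) (n : KillingField) : Set ℍ :=
  {z | z ∈ (⋃₀ A.lifts)ᶜ ∧ 0 < level n z ∧ ∀ m, A.IsLift m → geodesic m ≠ geodesic n →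
    ∀ p ∈ geodesic n, (0 < level m z ↔ 0 < level m p)}

/-- Near `q` no other lifted arc is present, so a short initial piece of a chord from `q` into the
positive half plane meets no arc after leaving `q`. -/
theorem exists_mem_sideTile (hρ₀ : IsSurfaceGroup ρ₀) [Finite ι] (A : ArcSystem ρ₀ ι)
    {n : KillingField} (hn : A.IsLift n) {q : ℍ} (hq : q ∈ geodesic n) {U : Set ℍ}
    (hU : IsOpen U) (hqU : q ∈ U) : (U ∩ A.sideTile n).Nonempty := by
  obtain ⟨W, hW, hqW, hWL⟩ := A.exists_isOpen_disjoint_lifts hρ₀ hn hq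
  obtain ⟨z₀, hz₀⟩ := hn.1.halfPlane_nonempty
  rw [mem_halfPlane_iff] at hz₀
  have hopen := (hU.inter hW).preimage (continuous_chord q z₀)
  obtain ⟨ε, hε, hball⟩ := Metric.isOpen_iff.1 hopen 0
    (by rw [mem_preimage, chord_zero]; exact ⟨hqU, hqW⟩)
  have hs0 : 0 < min (ε / 2) 1 := lt_min (by linarith) one_pos
  set s : unitInterval := ⟨min (ε / 2) 1, hs0.le, min_le_right _ _⟩ with hs
  have hsmall : ∀ t : unitInterval, t ≤ s → chord q z₀ t ∈ U ∩ W := by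
    intro t ht
    refine hball ?_
    rw [Metric.mem_ball, Subtype.dist_eq, Real.dist_eq]
    have h1 : (t : ℝ) ≤ ε / 2 := le_trans (show (t : ℝ) ≤ s from ht) (min_le_left _ _)
    have h2 := t.2.1
    simp only [Set.Icc.coe_zero, sub_zero, abs_of_nonneg h2]
    linarith
  have hpos : 0 < level n (chord q z₀ s) := by
    rw [level_chord, mem_geodesic_iff.1 hq, mul_zero, zero_add]
    exact mul_pos hs0 hz₀
  refine ⟨chord q z₀ s, (hsmall s le_rfl).1, ?_, hpos, ?_⟩
  · rintro ⟨L, hL, hsL⟩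
    by_cases hLn : L = geodesic n
    · rw [hLn, mem_geodesic_iff] at hsL
      exact hpos.ne' hsL
    · exact Set.disjoint_left.1 (hWL L hL hLn) (hsmall s le_rfl).2 hsL
  · intro m hm hmn p hp
    rw [level_pos_iff_of_disjoint (A.disjoint_lifts hρ₀ hn.2 hm.2 hmn.symm) hp hq]
    refine (level_pos_iff_of_chord fun t ht => ?_).symm
    -- A subchord is a reparametrized initial piece of the chord, as far as levels can detect.
    have hts : level m (chord q z₀ (s * t)) = 0 := by
      rw [mem_geodesic_iff, level_chord, level_chord] at ht
      rw [level_chord, ← ht]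
      push_cast
      ring
    exact Set.disjoint_left.1 (hWL _ hm.2 hmn)
      (hsmall (s * t) unitInterval.mul_le_left).2 (mem_geodesic_iff.2 hts)

theorem sideTile_nonempty (hρ₀ : IsSurfaceGroup ρ₀) [Finite ι] (A : ArcSystem ρ₀ ι)
    {n : KillingField} (hn : A.IsLift n) : (A.sideTile n).Nonempty := by
  obtain ⟨q, hq⟩ := hn.1.geodesic_nonempty
  exact (A.exists_mem_sideTile hρ₀ hn hq isOpen_univ (mem_univ q)).mono inter_subset_right

theorem geodesic_subset_closure_sideTile (hρ₀ : IsSurfaceGroup ρ₀) [Finite ι]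
    (A : ArcSystem ρ₀ ι) {n : KillingField} (hn : A.IsLift n) :
    geodesic n ⊆ closure (A.sideTile n) := fun _ hq =>
  mem_closure_iff.2 fun _ hU hqU => A.exists_mem_sideTile hρ₀ hn hq hU hqU

theorem sideTile_eq {A : ArcSystem ρ₀ ι} {n : KillingField} (hn : A.IsLift n) {z : ℍ}
    (hz : z ∈ A.sideTile n) : A.sideTile n = connectedComponentIn (⋃₀ A.lifts)ᶜ z := by
  ext y
  rw [mem_tile_iff hz.1]
  constructor
  · intro hy
    refine ⟨hy.1, fun m hm => ?_⟩
    by_cases hmn : geodesic m = geodesic n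
    · exact level_pos_iff_of_geodesic_eq hmn hy.2.1 hz.2.1
    · obtain ⟨p, hp⟩ := hn.1.geodesic_nonempty
      rw [hy.2.2 m hm hmn p hp, hz.2.2 m hm hmn p hp]
  · rintro ⟨hy, h⟩
    refine ⟨hy, (h n hn).2 hz.2.1, fun m hm hmn p hp => ?_⟩
    rw [h m hm, hz.2.2 m hm hmn p hp]

theorem adjacent_sideTile (hρ₀ : IsSurfaceGroup ρ₀) [Finite ι] (A : ArcSystem ρ₀ ι)
    {n : KillingField} (hn : A.IsLift n) :
    A.Adjacent (A.sideTile (-n)) (A.sideTile n) (geodesic n) := by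
  have mem : ∀ m, A.IsLift m → A.sideTile m ∈ A.tiles := by
    intro m hm
    obtain ⟨z, hz⟩ := A.sideTile_nonempty hρ₀ hm
    exact ⟨z, hz.1, sideTile_eq hm hz⟩
  refine ⟨mem _ hn.neg, mem _ hn, fun h => ?_, hn.2, ?_,
    A.geodesic_subset_closure_sideTile hρ₀ hn⟩
  · obtain ⟨z, hz⟩ := A.sideTile_nonempty hρ₀ hn
    have h1 := hz.2.1
    rw [← h] at hz
    have h2 := hz.2.1
    rw [level_neg] at h2
    linarith
  · have := A.geodesic_subset_closure_sideTile hρ₀ hn.neg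
    rwa [geodesic_neg] at this

/-! ### Nested lifted arcs -/

/-- The lifted arcs of `n` and `n'` are distinct and the positive half plane of the first is
contained in that of the second. -/
structure Nested (A : ArcSystem ρ₀ ι) (n n' : KillingField) : Prop where
  left : A.IsLift n
  right : A.IsLift n'
  ne : geodesic n ≠ geodesic n'
  subset : halfPlane n ⊆ halfPlane n'

variable {A : ArcSystem ρ₀ ι} {n n' : KillingField}

theorem Nested.level_pos (h : A.Nested n n') (hρ₀ : IsSurfaceGroup ρ₀) {p : ℍ}
    (hp : p ∈ geodesic n) : 0 < level n' p := by
  have h1 := form_nonneg_of_halfPlane_subset h.left.1.halfPlane_nonempty h.subset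
    (isFutureCausal_hyp p) (le_of_eq (Eq.symm hp))
  refine mem_halfPlane_iff.1 (lt_of_le_of_ne h1 fun h0 => ?_)
  exact Set.disjoint_left.1 (A.disjoint_lifts hρ₀ h.left.2 h.right.2 h.ne) hp h0.symm

theorem Nested.level_neg (h : A.Nested n n') (hρ₀ : IsSurfaceGroup ρ₀) {q : ℍ}
    (hq : q ∈ geodesic n') : level n q < 0 := by
  refine lt_of_le_of_ne ?_ fun h0 => ?_
  · by_contra! h0
    have := mem_halfPlane_iff.1 (h.subset (mem_halfPlane_iff.2 h0))
    exact this.ne' (mem_geodesic_iff.1 hq)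
  · exact Set.disjoint_left.1 (A.disjoint_lifts hρ₀ h.left.2 h.right.2 h.ne)
      (mem_geodesic_iff.2 h0) hq

theorem Nested.neg (h : A.Nested n n') (hρ₀ : IsSurfaceGroup ρ₀) : A.Nested (-n') (-n) := by
  refine ⟨h.right.neg, h.left.neg, by simpa only [geodesic_neg] using h.ne.symm, fun z hz => ?_⟩
  rw [mem_halfPlane_iff, CrookedStrip.level_neg] at *
  rcases lt_trichotomy (level n z) 0 with h0 | h0 | h0
  · linarith
  · have := h.level_pos hρ₀ (mem_geodesic_iff.2 h0)
    linarith
  · have := mem_halfPlane_iff.1 (h.subset (mem_halfPlane_iff.2 h0))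
    linarith

/-- A lifted arc that separates two nested lifted arcs lies between them. -/
theorem Nested.between (h : A.Nested n n') (hρ₀ : IsSurfaceGroup ρ₀) {m : KillingField}
    (hm : A.IsLift m) (hmn : geodesic m ≠ geodesic n) (hmn' : geodesic m ≠ geodesic n')
    {p q : ℍ} (hp : p ∈ geodesic n) (hq : q ∈ geodesic n') (hpm : 0 < level m p)
    (hqm : level m q ≤ 0) : A.Nested n m ∧ A.Nested m n' := by
  have hqm : level m q < 0 := lt_of_le_of_ne hqm fun h0 =>
    Set.disjoint_left.1 (A.disjoint_lifts hρ₀ hm.2 h.right.2 hmn') (mem_geodesic_iff.2 h0) hq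
  refine ⟨⟨h.left, hm, hmn.symm, ?_⟩, ?_⟩
  · refine (halfPlane_subset_or (A.disjoint_lifts hρ₀ h.left.2 hm.2 hmn.symm)
      hm.1.geodesic_nonempty hp hpm).resolve_right fun hsub => ?_
    have h1 : q ∈ halfPlane (-n) := by
      rw [mem_halfPlane_iff, CrookedStrip.level_neg]
      linarith [h.level_neg hρ₀ hq]
    linarith [mem_halfPlane_iff.1 (hsub h1)]
  · have h2 : A.Nested (-n') (-m) := by
      refine ⟨h.right.neg, hm.neg, by simpa only [geodesic_neg] using hmn'.symm, ?_⟩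
      have hdisj : Disjoint (geodesic (-n')) (geodesic (-m)) := by
        simpa only [geodesic_neg] using A.disjoint_lifts hρ₀ h.right.2 hm.2 hmn'.symm
      refine (halfPlane_subset_or hdisj hm.neg.1.geodesic_nonempty
        (by rw [geodesic_neg]; exact hq)
        (by rw [CrookedStrip.level_neg]; linarith)).resolve_right fun hsub => ?_
      rw [neg_neg] at hsub
      have h1 := hsub (mem_halfPlane_iff.2 (h.level_pos hρ₀ hp))
      rw [mem_halfPlane_iff, CrookedStrip.level_neg] at h1
      linarith
    simpa only [neg_neg] using h2.neg hρ₀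

/-- The lifted arcs strictly between two nested lifted arcs. -/
def between (A : ArcSystem ρ₀ ι) (n n' : KillingField) : Set (Set ℍ) :=
  {L | ∃ m, L = geodesic m ∧ A.Nested n m ∧ A.Nested m n'}

theorem Nested.trans_ne (hρ₀ : IsSurfaceGroup ρ₀) {m : KillingField} (h : A.Nested n m)
    (h' : A.Nested m n') : geodesic n ≠ geodesic n' := by
  intro hnn
  obtain ⟨p, hp⟩ := h.left.1.geodesic_nonempty
  have h1 := h.level_pos hρ₀ hp
  rw [hnn] at hp
  linarith [h'.level_neg hρ₀ hp]

theorem Nested.trans (hρ₀ : IsSurfaceGroup ρ₀) {m : KillingField} (h : A.Nested n m)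
    (h' : A.Nested m n') : A.Nested n n' :=
  ⟨h.left, h'.right, h.trans_ne hρ₀ h', h.subset.trans h'.subset⟩

/-- Every intermediate arc crosses one fixed chord joining the two geodesics, and that chord is
compact. -/
theorem finite_between (hρ₀ : IsSurfaceGroup ρ₀) [Finite ι] (h : A.Nested n n') :
    (A.between n n').Finite := by
  obtain ⟨p, hp⟩ := h.left.1.geodesic_nonempty
  obtain ⟨q, hq⟩ := h.right.1.geodesic_nonempty
  refine (A.finite_lifts_inter_compact hρ₀
    (isCompact_range (continuous_chord p q))).subset ?_
  rintro _ ⟨m, rfl, h1, h2⟩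
  obtain ⟨t, ht⟩ := exists_chord_mem_geodesic (h1.level_pos hρ₀ hp) (h2.level_neg hρ₀ hq).le
  exact ⟨h1.right.2, _, ht, t, rfl⟩

/-- Nested lifted arcs with nothing in between bound a common tile. -/
theorem Nested.sideTile_eq (h : A.Nested n n') (hρ₀ : IsSurfaceGroup ρ₀) [Finite ι]
    (hempty : A.between n n' = ∅) : A.sideTile (-n) = A.sideTile n' := by
  obtain ⟨z, hz⟩ := A.sideTile_nonempty hρ₀ h.left.neg
  obtain ⟨z', hz'⟩ := A.sideTile_nonempty hρ₀ h.right
  obtain ⟨p, hp⟩ := h.left.1.geodesic_nonempty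
  obtain ⟨q, hq⟩ := h.right.1.geodesic_nonempty
  have hzm : ∀ m, A.IsLift m → geodesic m ≠ geodesic n → (0 < level m z ↔ 0 < level m p) :=
    fun m hm hmn => hz.2.2 m hm (by rwa [geodesic_neg]) p (by rwa [geodesic_neg])
  have hzq : z' ∈ connectedComponentIn (⋃₀ A.lifts)ᶜ z := by
    rw [mem_tile_iff hz.1]
    refine ⟨hz'.1, fun m hm => ?_⟩
    by_cases hmn : geodesic m = geodesic n
    · rw [hz'.2.2 m hm (hmn ▸ h.ne) q hq]
      refine level_pos_iff_of_geodesic_eq (hmn.trans (geodesic_neg n).symm) ?_ hz.2.1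
      rw [CrookedStrip.level_neg]
      linarith [h.level_neg hρ₀ hq]
    by_cases hmn' : geodesic m = geodesic n'
    · rw [hzm m hm hmn]
      exact level_pos_iff_of_geodesic_eq hmn' hz'.2.1 (h.level_pos hρ₀ hp)
    rw [hz'.2.2 m hm hmn' q hq, hzm m hm hmn]
    -- An arc separating `p` from `q` would lie strictly between the two nested arcs.
    have aux : ∀ k, A.IsLift k → geodesic k = geodesic m → 0 < level k p → 0 < level k q := by
      intro k hk hkm hpk
      by_contra! hqk
      have := h.between hρ₀ hk (hkm ▸ hmn) (hkm ▸ hmn') hp hq hpk hqk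
      exact (hempty ▸ (⟨k, rfl, this⟩ : geodesic k ∈ A.between n n') : geodesic k ∈ (∅ : Set _))
    refine ⟨fun hqm => ?_, aux m hm rfl⟩
    by_contra! hpm
    have hpm : level m p < 0 := lt_of_le_of_ne hpm fun h0 =>
      Set.disjoint_left.1 (A.disjoint_lifts hρ₀ hm.2 h.left.2 hmn) (mem_geodesic_iff.2 h0) hp
    have := aux (-m) hm.neg (geodesic_neg m) (by rw [CrookedStrip.level_neg]; linarith)
    rw [CrookedStrip.level_neg] at this
    linarith
  rw [ArcSystem.sideTile_eq h.left.neg hz, ArcSystem.sideTile_eq h.right hz',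
    connectedComponentIn_eq hzq]

end ArcSystem
-- Unit normals of the same geodesic
theorem halfPlane_subset_of_geodesic_eq {n m : KillingField} (h : geodesic m = geodesic n)
    {z : ℍ} (hn : 0 < level n z) (hm : 0 < level m z) : halfPlane n ⊆ halfPlane m := by
  intro y hy
  rw [mem_halfPlane_iff] at *
  exact (level_pos_iff_of_geodesic_eq h hy hn).2 hm

theorem halfPlane_neg_subset_of_geodesic_eq {n m : KillingField} (h : geodesic m = geodesic n)
    (hsub : halfPlane m ⊆ halfPlane n) : halfPlane (-n) ⊆ halfPlane (-m) := by
  intro y hy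
  rw [mem_halfPlane_iff, level_neg] at *
  rcases lt_trichotomy (level m y) 0 with h0 | h0 | h0
  · linarith
  · rw [← mem_geodesic_iff, h, mem_geodesic_iff] at h0
    linarith
  · have := mem_halfPlane_iff.1 (hsub (mem_halfPlane_iff.2 h0))
    linarith

/-! ### Relative motions of tiles and arcs -/

namespace InfinitesimalStripDeformation

open ArcSystem

variable {Γ : Type*} [Group Γ] {ρ₀ : Γ →* PGL(2, ℝ)} {ι : Type*} {A : ArcSystem ρ₀ ι}

/-- The relative motion of the two tiles along a lifted arc moves points on opposite sides of the arc
apart. -/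
theorem relative_motion_form (hρ₀ : IsSurfaceGroup ρ₀) [Finite ι]
    (X : InfinitesimalStripDeformation A) {m : KillingField} (hm : A.IsLift m)
    {x y : KillingField} (hx : IsFutureCausal x) (hy : IsFutureCausal y) (hxm : 0 ≤ form x m)
    (hym : form y m ≤ 0) :
    form ⁅X.ξ (A.sideTile (-m)) - X.ξ (A.sideTile m), x⁆ y ≤ 0 ∧
      ((0 < form x m ∨ form y m < 0) →
        form ⁅X.ξ (A.sideTile (-m)) - X.ξ (A.sideTile m), x⁆ y < 0) := by
  have hadj := A.adjacent_sideTile hρ₀ hm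
  obtain ⟨γ, i, hL⟩ := hm.2
  rw [hL] at hadj
  obtain ⟨k, hk, hkL, hsub, htr⟩ := X.relative_motion γ i _ _ hadj
  have hw := X.width_pos i
  -- The normal `k` supplied by the deformation is compared with `m` only through half planes, which
  -- is enough to transfer all signs, weak and strict.
  have hkm : geodesic k = geodesic m := by rw [hkL, hL]
  obtain ⟨z, hz⟩ := A.sideTile_nonempty hρ₀ hm
  have hkz := mem_halfPlane_iff.1 (hsub hz)
  have h1 := halfPlane_subset_of_geodesic_eq hkm hz.2.1 hkz
  have h2 := halfPlane_subset_of_geodesic_eq hkm.symm hkz hz.2.1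
  have h3 := halfPlane_neg_subset_of_geodesic_eq hkm h2
  have h4 := halfPlane_neg_subset_of_geodesic_eq hkm.symm h1
  have hxk : 0 ≤ form x k :=
    form_nonneg_of_halfPlane_subset hm.1.halfPlane_nonempty h1 hx hxm
  have hyk : form y k ≤ 0 := by
    have := form_nonneg_of_halfPlane_subset hm.1.neg.halfPlane_nonempty h3 hy
      (by rw [form_neg_right]; linarith)
    rw [form_neg_right] at this
    linarith
  have hxk' : 0 < form x m → 0 < form x k := by
    intro h
    by_contra! h0
    have := form_nonneg_of_halfPlane_subset hk.neg.halfPlane_nonempty h4 hx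
      (by rw [form_neg_right]; linarith)
    rw [form_neg_right] at this
    linarith
  have hyk' : form y m < 0 → form y k < 0 := by
    intro h
    by_contra! h0
    linarith [form_nonneg_of_halfPlane_subset hk.halfPlane_nonempty h2 hy h0]
  rw [htr.form_bracket_eq hw, form_comm (hyp _) y, form_comm k y]
  have hxp := hx.form_hyp_neg (ρ₀ γ • X.waist i)
  have hyp' := hy.form_hyp_neg (ρ₀ γ • X.waist i)
  have e1 := mul_nonpos_of_nonneg_of_nonpos hxk hyp'.le
  have e2 := mul_nonneg_of_nonpos_of_nonpos hxp.le hyk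
  refine ⟨mul_nonpos_of_nonneg_of_nonpos hw.le (by linarith), fun h => ?_⟩
  refine mul_neg_of_pos_of_neg hw ?_
  rcases h with h | h
  · linarith [mul_neg_of_pos_of_neg (hxk' h) hyp']
  · linarith [mul_pos_of_neg_of_neg hxp (hyk' h)]

theorem form_nonneg_of_nested {n n' : KillingField} (h : A.Nested n n')
    {x : KillingField} (hx : IsFutureCausal x) (hxn : 0 ≤ form x n) : 0 ≤ form x n' :=
  form_nonneg_of_halfPlane_subset h.left.1.halfPlane_nonempty h.subset hx hxn

theorem form_nonpos_of_nested (hρ₀ : IsSurfaceGroup ρ₀) {n n' : KillingField}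
    (h : A.Nested n n') {y : KillingField} (hy : IsFutureCausal y) (hyn : form y n' ≤ 0) :
    form y n ≤ 0 := by
  have := form_nonneg_of_nested (h.neg hρ₀) hy (by rw [form_neg_right]; linarith)
  rw [form_neg_right] at this
  linarith

/-- The relative motion of the two tiles that face each other between nested lifted arcs. -/
theorem gap_motion_form (hρ₀ : IsSurfaceGroup ρ₀) [Finite ι]
    (X : InfinitesimalStripDeformation A) {x y : KillingField} (hx : IsFutureCausal x)
    (hy : IsFutureCausal y) {n n' : KillingField} (h : A.Nested n n') (hxn : 0 ≤ form x n)
    (hyn : form y n' ≤ 0) :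
    0 ≤ form ⁅X.ξ (A.sideTile (-n)) - X.ξ (A.sideTile n'), x⁆ y := by
  -- With no arc in between, the two facing tiles coincide. Otherwise any intermediate arc splits
  -- the gap into two smaller gaps and one strip.
  induction hN : (A.between n n').ncard using Nat.strong_induction_on generalizing n n' with
  | _ N ih =>
    have hfin := finite_between hρ₀ h
    rcases (A.between n n').eq_empty_or_nonempty with hempty | ⟨_, m, rfl, h1, h2⟩
    · rw [h.sideTile_eq hρ₀ hempty, sub_self, zero_lie]
      simp [form_eq]
    · have hm : geodesic m ∈ A.between n n' := ⟨m, rfl, h1, h2⟩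
      have hxm := form_nonneg_of_nested h1 hx hxn
      have hym := form_nonpos_of_nested hρ₀ h2 hy hyn
      have lt1 : (A.between n m).ncard < N := by
        rw [← hN]
        refine ncard_lt_ncard ((ssubset_iff_of_subset ?_).2 ⟨_, hm, ?_⟩) hfin
        · rintro _ ⟨k, rfl, hk, hk'⟩
          exact ⟨k, rfl, hk, hk'.trans hρ₀ h2⟩
        · rintro ⟨k, hmk, -, hk⟩
          exact hk.ne hmk.symm
      have lt2 : (A.between m n').ncard < N := by
        rw [← hN]
        refine ncard_lt_ncard ((ssubset_iff_of_subset ?_).2 ⟨_, hm, ?_⟩) hfin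
        · rintro _ ⟨k, rfl, hk, hk'⟩
          exact ⟨k, rfl, h1.trans hρ₀ hk, hk'⟩
        · rintro ⟨k, hmk, hk, -⟩
          exact hk.ne hmk
      have i1 := ih _ lt1 h1 hxn hym rfl
      have i2 := ih _ lt2 h2 hxm hyn rfl
      have i3 := (X.relative_motion_form hρ₀ h1.right hx hy hxm hym).1
      simp only [sub_lie, form_sub_left] at i1 i2 i3 ⊢
      linarith

/-- The motion of an arc is the average over its two sides, so the difference is the gap between the
facing tiles plus half of each end strip. Strictness comes from the end strips alone. -/
theorem motion_form (hρ₀ : IsSurfaceGroup ρ₀) [Finite ι]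
    (X : InfinitesimalStripDeformation A) {x y : KillingField} (hx : IsFutureCausal x)
    (hy : IsFutureCausal y) {n n' : KillingField} (h : A.Nested n n') (hxn : 0 ≤ form x n)
    (hyn : form y n' ≤ 0) :
    0 ≤ form ⁅X.motion (geodesic n) - X.motion (geodesic n'), x⁆ y ∧
      ((0 < form x n ∨ form y n < 0 ∨ 0 < form x n' ∨ form y n' < 0) →
        0 < form ⁅X.motion (geodesic n) - X.motion (geodesic n'), x⁆ y) := by
  have hxn' := form_nonneg_of_nested h hx hxn
  have hyn' := form_nonpos_of_nested hρ₀ h hy hyn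
  obtain ⟨a1, a2⟩ := X.relative_motion_form hρ₀ h.left hx hy hxn hyn'
  obtain ⟨b1, b2⟩ := X.relative_motion_form hρ₀ h.right hx hy hxn' hyn
  have c := X.gap_motion_form hρ₀ hx hy h hxn hyn
  rw [X.motion_eq _ _ _ (A.adjacent_sideTile hρ₀ h.left),
    X.motion_eq _ _ _ (A.adjacent_sideTile hρ₀ h.right)]
  simp only [sub_lie, add_lie, smul_lie, form_sub_left, form_add_left, form_smul_left]
    at a1 a2 b1 b2 c ⊢
  refine ⟨by linarith, ?_⟩
  rintro (h0 | h0 | h0 | h0)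
  · linarith [a2 (Or.inl h0)]
  · linarith [a2 (Or.inr h0)]
  · linarith [b2 (Or.inl h0)]
  · linarith [b2 (Or.inr h0)]

/-! ### Disjointness of opposite crooked halfspaces -/

theorem disjoint_CH (hρ₀ : IsSurfaceGroup ρ₀) [Finite ι] (X : InfinitesimalStripDeformation A)
    {n n' : KillingField} (h : A.Nested n n') :
    Disjoint (CH (X.motion (geodesic n)) n) (CH (X.motion (geodesic n')) (-n')) := by
  rw [Set.disjoint_left]
  rintro w ⟨x, hx, hxn, c, hc, hcx⟩ ⟨y, hy, hyn, d, hd, hdy⟩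
  rw [form_neg_right] at hyn
  have hyn : form y n' ≤ 0 := by linarith
  have hxn' := form_nonneg_of_nested h hx hxn
  have hyn' := form_nonpos_of_nested hρ₀ h hy hyn
  set v := X.motion (geodesic n) with hv
  set v' := X.motion (geodesic n') with hv'
  have hxy : form ⁅v - v', x⁆ y = -(c + d) * form x y := by
    have e1 : form ⁅w - v', x⁆ y = -form x ⁅w - v', y⁆ := by
      rw [← lie_skew, form_neg_left, form_bracket]
    have e2 : form ⁅v - v', x⁆ y = form ⁅w - v', x⁆ y - form ⁅w - v, x⁆ y := by
      rw [← form_sub_left, ← sub_lie, sub_sub_sub_cancel_left]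
    rw [e2, e1, hcx, hdy, form_smul_left, form_smul_right]
    ring
  have hle : form ⁅v - v', x⁆ y ≤ 0 := by
    rw [hxy]
    exact mul_nonpos_of_nonneg_of_nonpos (by linarith) (hx.form_nonpos hy)
  obtain ⟨-, hstrict⟩ := X.motion_form hρ₀ hx hy h hxn hyn
  have hall : form x n = 0 ∧ form y n = 0 ∧ form x n' = 0 ∧ form y n' = 0 := by
    refine ⟨?_, ?_, ?_, ?_⟩ <;> by_contra h0
    · exact (hstrict (Or.inl (lt_of_le_of_ne hxn (Ne.symm h0)))).not_ge hle
    · exact (hstrict (Or.inr (Or.inl (lt_of_le_of_ne hyn' h0)))).not_ge hle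
    · exact (hstrict (Or.inr (Or.inr (Or.inl (lt_of_le_of_ne hxn' (Ne.symm h0)))))).not_ge hle
    · exact (hstrict (Or.inr (Or.inr (Or.inr (lt_of_le_of_ne hyn h0))))).not_ge hle
  obtain ⟨x0, y0, x0', y0'⟩ := hall
  -- `x` and `y` represent the same ideal endpoint of the two arcs
  have hsum := hx.add hy
  -- If `x + y` were timelike, it would be a point of `ℍ` on both disjoint geodesics.
  have hnull : form (x + y) (x + y) = 0 := by
    refine le_antisymm hsum.1 (le_of_not_gt fun hlt => ?_)
    obtain ⟨s, hs, z, hz⟩ := hsum.exists_eq_smul_hyp hlt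
    have hz0 : ∀ k, form (x + y) k = 0 → z ∈ geodesic k := by
      intro k hk
      rw [hz, form_smul_left] at hk
      exact (mul_eq_zero.1 hk).resolve_left hs.ne'
    exact Set.disjoint_left.1 (A.disjoint_lifts hρ₀ h.left.2 h.right.2 h.ne)
      (hz0 n (by rw [form_add_left, x0, y0, add_zero]))
      (hz0 n' (by rw [form_add_left, x0', y0', add_zero]))
  have hxy0 : form x y = 0 := by
    rw [form_add_left, form_add_right, form_add_right, form_comm y x] at hnull
    linarith [hx.1, hy.1, hx.form_nonpos hy]
  obtain ⟨s, rfl⟩ := hx.exists_smul_eq hy hxy0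
  have hs : s ≠ 0 := by
    rintro rfl
    simpa using hy.2
  have hdx : ⁅w - v', x⁆ = d • x := by
    rw [lie_smul, smul_comm] at hdy
    exact smul_right_injective _ hs hdy
  have hD : ⁅v - v', x⁆ = (d - c) • x := by
    rw [sub_smul, ← hdx, ← hcx, ← sub_lie, sub_sub_sub_cancel_left]
  -- Testing `v - v'` on the pair `p`, `x` gives `0 < d - c`, and on the pair `x`, `q` gives `d - c
  -- < 0`; strictness holds because `p` and `q` each lie off the other geodesic.
  obtain ⟨p, hp⟩ := h.left.1.geodesic_nonempty
  obtain ⟨q, hq⟩ := h.right.1.geodesic_nonempty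
  have hpx := (X.motion_form hρ₀ (isFutureCausal_hyp p) hx h (le_of_eq (Eq.symm hp))
    x0'.le).2 (Or.inr (Or.inr (Or.inl (mem_halfPlane_iff.2 (h.level_pos hρ₀ hp)))))
  have hxq := (X.motion_form hρ₀ hx (isFutureCausal_hyp q) h x0.ge (le_of_eq hq)).2
    (Or.inr (Or.inl (form_hyp_neg_iff.2 (h.level_neg hρ₀ hq))))
  rw [← hv, ← hv', hD, form_smul_left] at hxq
  rw [← hv, ← hv', ← lie_skew, form_neg_left, form_bracket, hD, form_smul_right,
    form_comm] at hpx
  have e1 := hx.form_hyp_neg p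
  have e2 := hx.form_hyp_neg q
  have e3 : d - c < 0 := neg_of_mul_pos_left hxq e2.le
  linarith [mul_pos_of_neg_of_neg e3 e1]

end InfinitesimalStripDeformation
end CrookedStrip

theorem mainTheorem2 {Γ : Type*} [Group Γ] (ρ₀ : Γ →* PGL(2, ℝ))
    (hρ₀ : CrookedStrip.IsSurfaceGroup ρ₀) {ι : Type*} [Finite ι]
    (A : CrookedStrip.ArcSystem ρ₀ ι) (X : CrookedStrip.InfinitesimalStripDeformation A)
    (n n' : CrookedStrip.KillingField)
    (hn : CrookedStrip.IsUnitSpacelike n) (hn' : CrookedStrip.IsUnitSpacelike n')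
    (hα : CrookedStrip.geodesic n ∈ A.lifts) (hα' : CrookedStrip.geodesic n' ∈ A.lifts)
    (hne : CrookedStrip.geodesic n ≠ CrookedStrip.geodesic n')
    (hsub : CrookedStrip.halfPlane n ⊆ CrookedStrip.halfPlane n') :
    CrookedStrip.CH (X.motion (CrookedStrip.geodesic n)) n ⊆
      interior (CrookedStrip.CH (X.motion (CrookedStrip.geodesic n')) n') :=
  (X.disjoint_CH hρ₀ ⟨⟨hn, hα⟩, ⟨hn', hα'⟩, hne, hsub⟩).subset_compl_right.trans
    (CrookedStrip.compl_CH_neg_subset_interior_CH _ _)
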